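/- **Setting.** Let $(Y,Z,W)$ be a random vector with values in $\mathbb{R}\times\mathbb{R}\times\mathbb{R}^p$, and let $(Y_i,Z_i,W_i)$, $i\ge 1$, be independent copies of it. Let $\mathcal{G}$ be the space of functions $g:[0,1]\to\mathbb{R}$ that are differentiable with absolutely continuous first derivative and $\int_0^1|g''|^2<\infty$, let $\mathcal{H}=\{h\in\mathcal{G}: h(0)=h'(0)=0\}$ with inner product $\langle h_1,h_2\rangle_{\mathcal{H}}=\int_0^1 h_1''h_2''$, and let $g_0\in\mathcal{G}$ satisfy $\mathrm{E}\{Y-g_0(Z)\mid W\}=0$ almost surely. Assume: 1. $\mathrm{E}\,Y^2<\infty$; $Z$ has a bounded density with respect to Lebesgue measure on $[0,1]$; $\mu$ is a symmetric probability measure on $\mathbb{R}^p$ with support $\mathbb{R}^p$; and at least one component of $W$ is continuous (its law has no atoms). 2. (Completeness) The map $g\in\mathcal{G}\mapsto \mathrm{E}\{g(Z)\mid W\}$ is injective: if $g_1,g_2\in\mathcal{G}$ and $\mathrm{E}\{g_1(Z)\mid W\}=\mathrm{E}\{g_2(Z)\mid W\}$ almost surely, then $g_1=g_2$ on $[0,1]$.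 For $\lambda=\lambda_n>0$ let $\widehat g=\widehat g_n$ be (almost surely) a minimizer over $g\in\mathcal{G}$ of $$\int_{\mathbb{R}^p}\Bigl|\frac1n\sum_{i=1}^n (Y_i-g(Z_i))\,e^{\mathbf{i}W_i^\top t}\Bigr|^2d\mu(t)+\lambda\int_0^1|g''(z)|^2\,dz .$$ **Source condition with exponent $\gamma>0$.** Let $L^2_\mu$ be the space of $\mu$-square-integrable functions $\mathbb{R}^p\to\mathbb{C}$, regarded as a real Hilbert space. Define $A:\mathcal{H}\to L^2_\mu$ by $Ah=\mathrm{E}\{h(Z)e^{\mathbf{i}W^\top\cdot}\}$ and $B:\mathbb{R}^2\to L^2_\mu$ by $B\beta=\mathrm{E}\{(\beta_1+\beta_2Z)e^{\mathbf{i}W^\top\cdot}\}$. Let $M$ be the orthogonal projection of $L^2_\mu$ onto the orthogonal complement of the range of $B$, let $T=MA$, let $(\sigma_j,\varphi_j,\psi_j)_{j}$ be a singular system of $T$ ($\sigma_j>0$, $(\varphi_j)$ orthonormal in $\mathcal{H}$, $(\psi_j)$ orthonormal in $L^2_\mu$), and let $h_0(z)=g_0(z)-g_0(0)-g_0'(0)z$.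 The condition is $\sum_j\sigma_j^{-2\gamma}|\langle h_0,\varphi_j\rangle_{\mathcal{H}}|^2<\infty$. **Theorem.** If $\lambda\to0$ and $n\lambda\to\infty$ as $n\to\infty$, then $$\sup_{z\in[0,1]}|\widehat g(z)-g_0(z)|=o_P(1)\quad\text{and}\quad \sup_{z\in[0,1]}|\widehat g'(z)-g_0'(z)|=o_P(1).$$ If moreover the source condition holds with exponent $\gamma>0$, then $$\sup_{z\in[0,1]}|\widehat g(z)-g_0(z)|=O_P\Bigl(\frac1{\sqrt{n\lambda}}+\lambda^{\frac{\gamma\wedge2}{2}}\Bigr)\quad\text{and}\quad \sup_{z\in[0,1]}|\widehat g'(z)-g_0'(z)|=O_P\Bigl(\frac1{\sqrt{n\lambda}}+\lambda^{\frac{\gamma\wedge2}{2}}\Bigr).$$ -/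

import Mathlib

open MeasureTheory ProbabilityTheory Filter Topology Set
open scoped ENNReal

noncomputable section

namespace SplineIV

/-- The Euclidean space in which the instruments take their values. -/
abbrev E (p : ℕ) : Type := EuclideanSpace ℝ (Fin p)

/-! ### The function spaces on the unit interval -/

/-- First derivative on `[0,1]` (one-sided at the end points). -/
def d1 (g : ℝ → ℝ) : ℝ → ℝ := derivWithin g (Icc 0 1)

/-- Second derivative on `[0,1]`; for a function whose first derivative is absolutely continuous
it exists at almost every point. -/
def d2 (g : ℝ → ℝ) : ℝ → ℝ := derivWithin (d1 g) (Icc 0 1)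

/-- The space `𝒢`: functions that are differentiable on `[0,1]`, with absolutely continuous first
derivative and square integrable second derivative. Only the values on `[0,1]` matter. -/
def spaceG : Set (ℝ → ℝ) :=
  {g | DifferentiableOn ℝ g (Icc 0 1) ∧ AbsolutelyContinuousOnInterval (d1 g) 0 1 ∧
    MemLp (d2 g) 2 (volume.restrict (Icc 0 1))}

/-- The space `ℋ`: those elements `h` of `𝒢` with `h(0) = h'(0) = 0`. -/
def spaceH : Set (ℝ → ℝ) := {h | h ∈ spaceG ∧ h 0 = 0 ∧ d1 h 0 = 0}

/-- The inner product `⟨h₁, h₂⟩ = ∫₀¹ h₁'' h₂''` on `ℋ`. -/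
def innerH (h₁ h₂ : ℝ → ℝ) : ℝ := ∫ z in (0 : ℝ)..1, d2 h₁ z * d2 h₂ z

/-- The `ℋ`-part of `g` in the decomposition `g(z) = g(0) + g'(0) z + h(z)`. -/
def partH (g : ℝ → ℝ) : ℝ → ℝ := fun z => g z - g 0 - d1 g 0 * z

/-! ### The criterion and the estimator -/

/-- The function `exp(i wᵀt)`. -/
def expi {p : ℕ} (w t : E p) : ℂ := Complex.exp (Complex.I * ((inner ℝ w t : ℝ) : ℂ))

/-- The empirical criterion `M_n(g) = ∫ |n⁻¹ ∑ᵢ (yᵢ - g(zᵢ)) exp(i wᵢᵀ t)|² dμ(t)` for the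
observations with index `i < n`. -/
def criterion {p : ℕ} (μ : Measure (E p)) (n : ℕ) (y z : ℕ → ℝ) (w : ℕ → E p)
    (g : ℝ → ℝ) : ℝ :=
  ∫ t, ‖(n : ℂ)⁻¹ * ∑ i ∈ Finset.range n, ((y i - g (z i) : ℝ) : ℂ) * expi (w i) t‖ ^ 2 ∂μ

/-- The penalized empirical criterion `M_n(g) + lam * ∫₀¹ |g''|²`. -/
def penalizedCriterion {p : ℕ} (μ : Measure (E p)) (lam : ℝ) (n : ℕ) (y z : ℕ → ℝ)
    (w : ℕ → E p) (g : ℝ → ℝ) : ℝ :=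
  criterion μ n y z w g + lam * ∫ x in (0 : ℝ)..1, d2 g x ^ 2

/-- `g` is a smoothing spline IV estimate: it minimizes the penalized criterion over `𝒢`. -/
def IsSplineEstimate {p : ℕ} (μ : Measure (E p)) (lam : ℝ) (n : ℕ) (y z : ℕ → ℝ)
    (w : ℕ → E p) (g : ℝ → ℝ) : Prop :=
  g ∈ spaceG ∧ IsMinOn (penalizedCriterion μ lam n y z w) spaceG g

/-! ### The population operators and the source condition -/

section Operators

variable {Ω : Type*} [MeasurableSpace Ω]

/-- `t ↦ 𝔼[f exp(i Wᵀ t)]`. -/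
def expMoment {p : ℕ} (P : Measure Ω) (W : Ω → E p) (f : Ω → ℝ) (t : E p) : ℂ :=
  ∫ ω, (f ω : ℂ) * expi (W ω) t ∂P

lemma norm_expi {p : ℕ} (w t : E p) : ‖expi w t‖ = 1 := by
  rw [expi, mul_comm]
  exact Complex.norm_exp_ofReal_mul_I _

lemma continuous_expi {p : ℕ} : Continuous fun x : E p × E p => expi x.1 x.2 := by
  unfold expi
  fun_prop

lemma memLp_expMoment {p : ℕ} (P : Measure Ω) (μ : Measure (E p)) [IsProbabilityMeasure μ]
    {W : Ω → E p} (hW : Measurable W) (f : Ω → ℝ) :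
    MemLp (expMoment P W f) 2 μ := by
  have hmeas : ∀ t, Measurable fun ω => expi (W ω) t := fun t =>
    (continuous_expi.comp (Continuous.prodMk_left t)).measurable.comp hW
  by_cases hf : Integrable f P
  · have hc : Continuous (expMoment P W f) := by
      unfold expMoment
      refine continuous_of_dominated (bound := fun ω => ‖f ω‖) ?_ ?_ hf.norm ?_
      · intro t
        exact hf.ofReal.aestronglyMeasurable.mul (hmeas t).aestronglyMeasurable
      · intro t
        refine Eventually.of_forall fun ω => ?_
        simp [norm_expi]
      · refine Eventually.of_forall fun ω => ?_
        exact continuous_const.mul (continuous_expi.comp (Continuous.prodMk_right (W ω)))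
    refine MemLp.of_bound hc.aestronglyMeasurable (∫ ω, ‖f ω‖ ∂P)
      (Eventually.of_forall fun t => ?_)
    refine (norm_integral_le_integral_norm _).trans_eq ?_
    simp [norm_expi]
  · have h0 : expMoment P W f = 0 := by
      funext t
      refine integral_undef fun h => hf ?_
      have h1 : Integrable (fun ω => (f ω : ℂ)) P := by
        refine (h.mul_bdd (c := 1) (g := fun ω => expi (W ω) (-t))
          (hmeas (-t)).aestronglyMeasurable ?_).congr ?_
        · exact Eventually.of_forall fun ω => (norm_expi _ _).le
        · refine Eventually.of_forall fun ω => ?_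
          simp [mul_assoc, expi, ← Complex.exp_add]
      simpa using h1.re
    rw [h0]
    exact MemLp.zero

/-- `𝔼[f exp(i Wᵀ ·)]` as an element of the space `L²_μ` of complex functions; this space is used
as a Hilbert space over `ℝ`, because the operators below act on real spaces. -/
def expMomentLp {p : ℕ} (P : Measure Ω) (μ : Measure (E p)) [IsProbabilityMeasure μ]
    {W : Ω → E p} (hW : Measurable W) (f : Ω → ℝ) : Lp ℂ 2 μ :=
  (memLp_expMoment P μ hW f).toLp

/-- The operator `A h = 𝔼[h(Z) exp(i Wᵀ ·)]`. -/
def opA {p : ℕ} (P : Measure Ω) (μ : Measure (E p)) [IsProbabilityMeasure μ]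
    (Z : Ω → ℝ) {W : Ω → E p} (hW : Measurable W) (h : ℝ → ℝ) : Lp ℂ 2 μ :=
  expMomentLp P μ hW fun ω => h (Z ω)

/-- The operator `B β = 𝔼[(1, Z) β exp(i Wᵀ ·)]` for `β ∈ ℝ²`. -/
def opB {p : ℕ} (P : Measure Ω) (μ : Measure (E p)) [IsProbabilityMeasure μ]
    (Z : Ω → ℝ) {W : Ω → E p} (hW : Measurable W) (β : ℝ × ℝ) : Lp ℂ 2 μ :=
  expMomentLp P μ hW fun ω => β.1 + β.2 * Z ω

/-- The operator `T = M A`, with `M` the orthogonal projection onto the orthogonal complement of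
the span of (the range of) `B`. -/
def opT {p : ℕ} (P : Measure Ω) (μ : Measure (E p)) [IsProbabilityMeasure μ]
    (Z : Ω → ℝ) {W : Ω → E p} (hW : Measurable W) (h : ℝ → ℝ) : Lp ℂ 2 μ :=
  (Submodule.span ℝ (Set.range (opB P μ Z hW)))ᗮ.starProjection (opA P μ Z hW h)

/-- `(σ j, φ j, ψ j)` is a singular system of the operator `T : ℋ → L²_μ`. -/
structure IsSingularSystem {p : ℕ} {μ : Measure (E p)} (T : (ℝ → ℝ) → Lp ℂ 2 μ)
    (σ : ℕ → ℝ) (φ : ℕ → ℝ → ℝ) (ψ : ℕ → Lp ℂ 2 μ) : Prop where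
  pos : ∀ j, 0 < σ j
  mem : ∀ j, φ j ∈ spaceH
  orthonormal_left : ∀ i j, innerH (φ i) (φ j) = if i = j then 1 else 0
  orthonormal_right : Orthonormal ℝ ψ
  /-- `T φ_j = σ_j ψ_j` -/
  map_eq : ∀ j, T (φ j) = σ j • ψ j
  /-- `T* ψ_j = σ_j φ_j` -/
  adjoint_eq : ∀ j, ∀ h ∈ spaceH, inner ℝ (T h) (ψ j) = σ j * innerH h (φ j)
  /-- the `φ_j` span the orthogonal complement of the null space of `T` -/
  complete : ∀ h ∈ spaceH, (∀ j, innerH h (φ j) = 0) → T h = 0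

/-- The source condition with exponent `γ` for the function `g`, whose `ℋ`-part is `h`:
`∑_j σ_j^(-2γ) ⟨h, φ_j⟩² < ∞`. -/
def SourceCondition {p : ℕ} (P : Measure Ω) (μ : Measure (E p)) [IsProbabilityMeasure μ]
    (Z : Ω → ℝ) {W : Ω → E p} (hW : Measurable W) (g : ℝ → ℝ) (γ : ℝ) : Prop :=
  ∃ (σ : ℕ → ℝ) (φ : ℕ → ℝ → ℝ) (ψ : ℕ → Lp ℂ 2 μ),
    IsSingularSystem (opT P μ Z hW) σ φ ψ ∧
    Summable fun j => σ j ^ (-(2 * γ)) * innerH (partH g) (φ j) ^ 2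

end Operators

/-! ### Stochastic orders -/

/-- `X_n = O_P(a_n)`. -/
def IsBigOP {Ω : Type*} [MeasurableSpace Ω] (P : Measure Ω) (X : ℕ → Ω → ℝ) (a : ℕ → ℝ) : Prop :=
  ∀ ε : ℝ, 0 < ε → ∃ C : ℝ, ∀ᶠ n in atTop, P {ω | C * a n < |X n ω|} ≤ ENNReal.ofReal ε

/-- The uniform distance on `[0,1]` (used for functions that are bounded there). -/
def supDist (f g : ℝ → ℝ) : ℝ := ⨆ z : Icc (0 : ℝ) 1, |f z - g z|

end SplineIV

end

open SplineIV

/-!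
# Uniform convergence of the smoothing spline instrumental variable estimator

By the Taylor formula with integral remainder, the elements of `𝒢` correspond to the triples
`x = ((g(0), g'(0)), g'')` in `ℝ² × L²[0,1]` (`spl`, `coef`), and the uniform norms of `g` and of
`g'` on `[0,1]` are bounded by the norm of `x` (`supDist_le`). In these coordinates the estimator
minimizes `‖r̂ - Ŝ x‖² + lam ‖g''‖²`, where `Ŝ` (`empOp`) is the empirical version of
`S x = 𝔼[g(Z) exp(i Wᵀ ·)]` (`opS`). Completeness, the uniqueness theorem for characteristic
functions and the full support of `μ` make `S` injective (`opS_injective`). As the unpenalized part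
`ℝ²` has finite dimension, it follows that `‖x‖ ≤ c (‖S x‖ + ‖g''‖)`
(`exists_norm_le_of_injective`).

Let `d` be the bias of the penalized population problem. Subtracting its normal equations from those
of the estimator, and testing the difference with `e = x̂ - x₀ - d`, gives `‖e‖ ≤ C D / √lam`, where
`D` bounds the noise and `‖Ŝ - S‖` (`norm_sub_le_of_normal_equations`). Since the values of `spl x`
are inner products of `x` with explicit kernels, the Hilbert-Schmidt norm of `Ŝ - S` is an integral
of squared deviations of scalar empirical moments (`enorm_sq_empOp_sub_le`), which have expectation
of order `1 / n` (`exists_measure_totalDev_le`); so `D = O_P(n ^ (-1/2))`.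

The unpenalized part of `d` is eliminated by the projection `M`: the penalized part `k` is the bias
`-lam (lam + T* T)⁻¹ h₀` of Tikhonov regularization with `T = M A` (`profileOp`,
`exists_full_bias`). It tends to `0` because `T` is injective (`tendsto_tikhonovBias`), and the
source condition makes it `O(lam ^ (min γ 2 / 2))` by the singular value expansion
(`exists_tikhonovBias_le`).
-/

noncomputable section

namespace SplineIV

/-! ### Coordinates on the spline space -/

/-- The Hilbert space `L²[0,1]`, in which the second derivatives live. -/
abbrev L2I : Type := Lp ℝ 2 (volume.restrict (Icc (0 : ℝ) 1))

/-- Coordinates `((g(0), g'(0)), g'')` of the elements `g` of `𝒢`. -/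
abbrev Coef : Type := (ℝ × ℝ) × L2I

/-- The function with value `a` and slope `b` at `0` and second derivative `u`. It is defined on the
whole line, although only its restriction to `[0,1]` matters. -/
def spl (x : Coef) (z : ℝ) : ℝ :=
  x.1.1 + x.1.2 * z + ∫ s in Icc (0 : ℝ) 1, max (z - s) 0 * x.2 s

/-- The derivative of `spl x`. -/
def splDeriv (x : Coef) (z : ℝ) : ℝ :=
  x.1.2 + ∫ s in Icc (0 : ℝ) 1, (Iio z).indicator x.2 s

lemma integrable_L2I (u : L2I) : Integrable u (volume.restrict (Icc (0 : ℝ) 1)) :=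
  (Lp.memLp u).integrable (by norm_num)

lemma integral_norm_L2I_le (u : L2I) : ∫ s in Icc (0 : ℝ) 1, ‖u s‖ ≤ ‖u‖ := by
  have h1 : eLpNorm u 1 (volume.restrict (Icc (0 : ℝ) 1)) ≤
      eLpNorm u 2 (volume.restrict (Icc (0 : ℝ) 1)) := by
    have : IsProbabilityMeasure (volume.restrict (Icc (0 : ℝ) 1)) := ⟨by simp⟩
    exact eLpNorm_le_eLpNorm_of_exponent_le (by norm_num) (Lp.memLp u).aestronglyMeasurable
  rw [Lp.norm_def, integral_norm_eq_lintegral_enorm (Lp.memLp u).aestronglyMeasurable]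
  rw [eLpNorm_one_eq_lintegral_enorm] at h1
  exact ENNReal.toReal_mono (Lp.memLp u).2.ne h1

lemma integrable_max_mul (u : L2I) (z : ℝ) :
    Integrable (fun s => max (z - s) 0 * u s) (volume.restrict (Icc (0 : ℝ) 1)) := by
  refine (integrable_L2I u).bdd_mul (c := |z| + 1) ?_ ?_
  · exact Continuous.aestronglyMeasurable (by fun_prop)
  · refine (ae_restrict_mem measurableSet_Icc).mono fun s hs => ?_
    rw [Real.norm_eq_abs, abs_of_nonneg (le_max_right _ _)]
    refine max_le ?_ (by positivity)
    linarith [le_abs_self z, hs.1]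

lemma spl_add (x y : Coef) (z : ℝ) : spl (x + y) z = spl x z + spl y z := by
  have h : ∫ s in Icc (0 : ℝ) 1, max (z - s) 0 * (x + y).2 s =
      ∫ s in Icc (0 : ℝ) 1, (max (z - s) 0 * x.2 s + max (z - s) 0 * y.2 s) := by
    refine integral_congr_ae ?_
    filter_upwards [Lp.coeFn_add x.2 y.2] with s hs
    rw [Prod.snd_add, hs, Pi.add_apply, mul_add]
  rw [spl, h, integral_add (integrable_max_mul _ _) (integrable_max_mul _ _), spl, spl]
  simp only [Prod.fst_add, Prod.snd_add]
  ring

lemma spl_smul (c : ℝ) (x : Coef) (z : ℝ) : spl (c • x) z = c * spl x z := by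
  have h : ∫ s in Icc (0 : ℝ) 1, max (z - s) 0 * (c • x).2 s =
      ∫ s in Icc (0 : ℝ) 1, c * (max (z - s) 0 * x.2 s) := by
    refine integral_congr_ae ?_
    filter_upwards [Lp.coeFn_smul c x.2] with s hs
    rw [Prod.smul_snd, hs, Pi.smul_apply, smul_eq_mul]
    ring
  rw [spl, h, integral_const_mul, spl]
  simp only [Prod.smul_fst, Prod.smul_snd, smul_eq_mul]
  ring

lemma spl_sub (x y : Coef) (z : ℝ) : spl (x - y) z = spl x z - spl y z := by
  have : x - y = x + (-1 : ℝ) • y := by simp [sub_eq_add_neg]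
  rw [this, spl_add, spl_smul]
  ring

lemma spl_affine (β : ℝ × ℝ) (z : ℝ) : spl (β, 0) z = β.1 + β.2 * z := by
  have : ∫ s in Icc (0 : ℝ) 1, max (z - s) 0 * (0 : L2I) s = ∫ s in Icc (0 : ℝ) 1, (0 : ℝ) := by
    refine integral_congr_ae ?_
    filter_upwards [Lp.coeFn_zero ℝ 2 (volume.restrict (Icc (0 : ℝ) 1))] with s hs
    rw [hs]
    simp
  rw [spl, this]
  simp

lemma hasDerivAt_spl (x : Coef) (z : ℝ) : HasDerivAt (spl x) (splDeriv x z) z := by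
  have h := (hasDerivAt_integral_of_dominated_loc_of_lip (𝕜 := ℝ)
    (μ := volume.restrict (Icc (0 : ℝ) 1)) (F := fun z s => max (z - s) 0 * x.2 s)
    (F' := (Iio z).indicator x.2) (x₀ := z) (s := univ) (bound := fun s => ‖x.2 s‖)
    univ_mem (Eventually.of_forall fun y => (integrable_max_mul x.2 y).aestronglyMeasurable)
    (integrable_max_mul x.2 z)
    ((Lp.memLp x.2).aestronglyMeasurable.indicator measurableSet_Iio) ?_
    (integrable_L2I x.2).norm ?_).2
  · have h1 : HasDerivAt (fun z : ℝ => x.1.1 + x.1.2 * z) x.1.2 z := by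
      simpa using ((hasDerivAt_id z).const_mul x.1.2).const_add x.1.1
    exact h1.add h
  · refine Eventually.of_forall fun s => LipschitzOnWith.of_dist_le_mul fun a _ b _ => ?_
    rw [Real.coe_nnabs, abs_norm, Real.dist_eq, ← sub_mul, abs_mul, mul_comm, Real.norm_eq_abs,
      Real.dist_eq]
    refine mul_le_mul_of_nonneg_left ?_ (abs_nonneg _)
    refine (abs_max_sub_max_le_abs (a - s) (b - s) 0).trans_eq ?_
    rw [sub_sub_sub_cancel_right]
  · have : ∀ᵐ s ∂(volume.restrict (Icc (0 : ℝ) 1)), s ≠ z :=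
      ae_restrict_of_ae (by simp [ae_iff, measure_singleton])
    filter_upwards [this] with s hs
    rcases lt_or_gt_of_ne hs with h | h
    · have e : (fun y => max (y - s) 0 * x.2 s) =ᶠ[𝓝 z] fun y => (y - s) * x.2 s := by
        filter_upwards [lt_mem_nhds h] with y hy
        rw [max_eq_left (by linarith)]
      refine HasDerivAt.congr_of_eventuallyEq ?_ e
      rw [indicator_of_mem (show s ∈ Iio z from h)]
      simpa using ((hasDerivAt_id z).sub_const s).mul_const (x.2 s)
    · have e : (fun y => max (y - s) 0 * x.2 s) =ᶠ[𝓝 z] fun y => 0 := by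
        filter_upwards [gt_mem_nhds h] with y hy
        rw [max_eq_right (by linarith), zero_mul]
      refine HasDerivAt.congr_of_eventuallyEq ?_ e
      rw [indicator_of_notMem (by simpa using h.le)]
      exact hasDerivAt_const _ _

lemma continuous_spl (x : Coef) : Continuous (spl x) :=
  continuous_iff_continuousAt.2 fun z => (hasDerivAt_spl x z).continuousAt

lemma d1_spl (x : Coef) {z : ℝ} (hz : z ∈ Icc (0 : ℝ) 1) : d1 (spl x) z = splDeriv x z :=
  (hasDerivAt_spl x z).hasDerivWithinAt.derivWithin (uniqueDiffOn_Icc one_pos z hz)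

lemma intervalIntegrable_L2I (u : L2I) : IntervalIntegrable u volume 0 1 := by
  rw [intervalIntegrable_iff_integrableOn_Icc_of_le zero_le_one]
  exact integrable_L2I u

lemma splDeriv_eq (x : Coef) {z : ℝ} (hz : z ∈ Icc (0 : ℝ) 1) :
    splDeriv x z = x.1.2 + ∫ s in (0 : ℝ)..z, x.2 s := by
  rw [splDeriv, integral_indicator measurableSet_Iio, intervalIntegral.integral_of_le hz.1,
    Measure.restrict_restrict measurableSet_Iio]
  congr 1
  refine setIntegral_congr_set ?_
  have : Iio z ∩ Icc 0 1 = Ico 0 z := by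
    ext s
    simp only [mem_inter_iff, mem_Iio, mem_Icc, mem_Ico]
    exact ⟨fun h => ⟨h.2.1, h.1⟩, fun h => ⟨h.2, h.1, h.2.le.trans hz.2⟩⟩
  rw [this]
  exact Ico_ae_eq_Ioc

lemma absolutelyContinuous_congr {f g : ℝ → ℝ} {a b : ℝ} (h : EqOn f g (uIcc a b))
    (hf : AbsolutelyContinuousOnInterval f a b) : AbsolutelyContinuousOnInterval g a b := by
  rw [absolutelyContinuousOnInterval_iff] at hf ⊢
  intro ε hε
  obtain ⟨δ, hδ, H⟩ := hf ε hε
  refine ⟨δ, hδ, fun E hE hEδ => ?_⟩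
  refine lt_of_eq_of_lt (Finset.sum_congr rfl fun i hi => ?_) (H E hE hEδ)
  rw [h (hE.1 i hi).1, h (hE.1 i hi).2]

lemma absolutelyContinuous_d1_spl (x : Coef) : AbsolutelyContinuousOnInterval (d1 (spl x)) 0 1 := by
  have h1 := (intervalIntegrable_L2I x.2).absolutelyContinuousOnInterval_intervalIntegral
    (c := 0) (by simp)
  have h2 : AbsolutelyContinuousOnInterval (fun _ : ℝ => x.1.2) 0 1 :=
    (LipschitzWith.const x.1.2).lipschitzOnWith.absolutelyContinuousOnInterval
  refine absolutelyContinuous_congr ?_ (h2.add h1)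
  intro z hz
  rw [uIcc_of_le zero_le_one] at hz
  rw [d1_spl x hz, splDeriv_eq x hz]
  rfl

lemma ae_mem_Ioo : ∀ᵐ z ∂(volume.restrict (Icc (0 : ℝ) 1)), z ∈ Ioo (0 : ℝ) 1 := by
  rw [← restrict_Ioo_eq_restrict_Icc]
  exact ae_restrict_mem measurableSet_Ioo

lemma d2_spl (x : Coef) : d2 (spl x) =ᵐ[volume.restrict (Icc (0 : ℝ) 1)] x.2 := by
  have h := ae_restrict_of_ae (s := Icc (0 : ℝ) 1)
    (intervalIntegrable_L2I x.2).ae_hasDerivAt_integral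
  filter_upwards [h, ae_mem_Ioo] with z hz hz01
  have hzI := Ioo_subset_Icc_self hz01
  have h1 := (hz (by rwa [uIcc_of_le zero_le_one]) 0 (by simp)).const_add x.1.2
  have h2 : HasDerivWithinAt (d1 (spl x)) (x.2 z) (Icc 0 1) z :=
    h1.hasDerivWithinAt.congr (fun y hy => by rw [d1_spl x hy, splDeriv_eq x hy])
      (by rw [d1_spl x hzI, splDeriv_eq x hzI])
  exact h2.derivWithin (uniqueDiffOn_Icc one_pos z hzI)

lemma spl_mem_spaceG (x : Coef) : spl x ∈ spaceG :=
  ⟨fun z _ => (hasDerivAt_spl x z).differentiableAt.differentiableWithinAt,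
    absolutelyContinuous_d1_spl x, (memLp_congr_ae (d2_spl x)).2 (Lp.memLp x.2)⟩

lemma spl_zero (x : Coef) : spl x 0 = x.1.1 := by
  have : ∫ s in Icc (0 : ℝ) 1, max (0 - s) 0 * x.2 s = ∫ s in Icc (0 : ℝ) 1, (0 : ℝ) := by
    refine setIntegral_congr_fun measurableSet_Icc fun s hs => ?_
    rw [max_eq_right (by linarith [hs.1]), zero_mul]
  rw [spl, this]
  simp

lemma d1_spl_zero (x : Coef) : d1 (spl x) 0 = x.1.2 := by
  rw [d1_spl x (by simp), splDeriv_eq x (by simp)]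
  simp

lemma d1_congr {f g : ℝ → ℝ} (h : EqOn f g (Icc 0 1)) : EqOn (d1 f) (d1 g) (Icc 0 1) :=
  fun _ hz => derivWithin_congr h (h hz)

lemma d2_congr {f g : ℝ → ℝ} (h : EqOn f g (Icc 0 1)) : EqOn (d2 f) (d2 g) (Icc 0 1) :=
  fun _ hz => derivWithin_congr (d1_congr h) (d1_congr h hz)

/-- An element of `Coef` is determined by the values of its function on `[0,1]`. -/
lemma spl_injective {x y : Coef} (h : EqOn (spl x) (spl y) (Icc 0 1)) : x = y := by
  have h0 : (0 : ℝ) ∈ Icc (0 : ℝ) 1 := by simp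
  refine Prod.ext (Prod.ext ?_ ?_) ?_
  · rw [← spl_zero x, ← spl_zero y, h h0]
  · rw [← d1_spl_zero x, ← d1_spl_zero y, d1_congr h h0]
  · refine Lp.ext ?_
    filter_upwards [d2_spl x, d2_spl y, ae_restrict_mem measurableSet_Icc] with s hx hy hs
    rw [← hx, ← hy, d2_congr h hs]

/-- The coordinates of an element of `𝒢`. -/
def coef (g : ℝ → ℝ) (hg : g ∈ spaceG) : Coef := ((g 0, d1 g 0), hg.2.2.toLp)

lemma d1_eq_of_mem_spaceG {g : ℝ → ℝ} (hg : g ∈ spaceG) {z : ℝ} (hz : z ∈ Icc (0 : ℝ) 1) :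
    d1 g z = d1 g 0 + ∫ s in (0 : ℝ)..z, d2 g s := by
  have hac : AbsolutelyContinuousOnInterval (d1 g) 0 z :=
    hg.2.1.mono (by rw [uIcc_of_le hz.1, uIcc_of_le zero_le_one]; exact Icc_subset_Icc_right hz.2)
  have h := hac.integral_deriv_eq_sub
  have h1 : ∫ s in (0 : ℝ)..z, d2 g s = ∫ s in (0 : ℝ)..z, deriv (d1 g) s := by
    refine intervalIntegral.integral_congr_ae_restrict ?_
    rw [uIoc_of_le hz.1, ← restrict_Ioo_eq_restrict_Ioc]
    refine (ae_restrict_mem measurableSet_Ioo).mono fun s hs => ?_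
    exact derivWithin_of_mem_nhds (Icc_mem_nhds hs.1 (hs.2.trans_le hz.2))
  rw [h1, h]
  ring

/-- Every element of `𝒢` agrees on `[0,1]` with the function of its coordinates: this is the Taylor
formula with integral remainder. -/
lemma spl_coef {g : ℝ → ℝ} (hg : g ∈ spaceG) : EqOn (spl (coef g hg)) g (Icc 0 1) := by
  have hd : EqOn (d1 (spl (coef g hg))) (d1 g) (Icc 0 1) := by
    intro z hz
    rw [d1_spl _ hz, splDeriv_eq _ hz, d1_eq_of_mem_spaceG hg hz]
    simp only [coef]
    congr 1
    refine intervalIntegral.integral_congr_ae_restrict ?_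
    rw [uIoc_of_le hz.1]
    exact ae_restrict_of_ae_restrict_of_subset
      (Ioc_subset_Icc_self.trans (Icc_subset_Icc_right hz.2)) hg.2.2.coeFn_toLp
  intro z hz
  have hdiff : DifferentiableOn ℝ (fun z => spl (coef g hg) z - g z) (Icc 0 1) :=
    (spl_mem_spaceG _).1.sub hg.1
  have hzero : ∀ y ∈ Icc (0 : ℝ) 1,
      derivWithin (fun z => spl (coef g hg) z - g z) (Icc 0 1) y = 0 := by
    intro y hy
    rw [derivWithin_fun_sub ((spl_mem_spaceG _).1 y hy) (hg.1 y hy)]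
    exact sub_eq_zero.2 (hd hy)
  have := constant_of_derivWithin_zero hdiff (fun y hy => hzero y (Ico_subset_Icc_self hy)) z hz
  rw [spl_zero] at this
  simp only [coef] at this
  rw [sub_self] at this
  exact sub_eq_zero.1 this

lemma abs_spl_le (x : Coef) {z : ℝ} (hz : z ∈ Icc (0 : ℝ) 1) : |spl x z| ≤ 3 * ‖x‖ := by
  have h1 : |x.1.1| ≤ ‖x‖ := (norm_fst_le x.1).trans (norm_fst_le x)
  have h2 : |x.1.2| ≤ ‖x‖ := (norm_snd_le x.1).trans (norm_fst_le x)
  have h3 : |∫ s in Icc (0 : ℝ) 1, max (z - s) 0 * x.2 s| ≤ ‖x‖ := by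
    refine le_trans ?_ ((integral_norm_L2I_le x.2).trans (norm_snd_le x))
    rw [← Real.norm_eq_abs]
    refine norm_integral_le_of_norm_le (integrable_L2I x.2).norm ?_
    refine (ae_restrict_mem measurableSet_Icc).mono fun s hs => ?_
    rw [norm_mul]
    refine mul_le_of_le_one_left (norm_nonneg _) ?_
    rw [Real.norm_eq_abs, abs_of_nonneg (le_max_right _ _)]
    exact max_le (by linarith [hz.2, hs.1]) zero_le_one
  have h4 : |x.1.2 * z| ≤ ‖x‖ := by
    rw [abs_mul, abs_of_nonneg hz.1]
    exact (mul_le_of_le_one_right (abs_nonneg _) hz.2).trans h2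
  rw [spl]
  refine (abs_add_le _ _).trans ?_
  linarith [abs_add_le x.1.1 (x.1.2 * z)]

lemma abs_splDeriv_le (x : Coef) (z : ℝ) : |splDeriv x z| ≤ 3 * ‖x‖ := by
  have h2 : |x.1.2| ≤ ‖x‖ := (norm_snd_le x.1).trans (norm_fst_le x)
  have h3 : |∫ s in Icc (0 : ℝ) 1, (Iio z).indicator x.2 s| ≤ ‖x‖ := by
    refine le_trans ?_ ((integral_norm_L2I_le x.2).trans (norm_snd_le x))
    rw [← Real.norm_eq_abs]
    refine norm_integral_le_of_norm_le (integrable_L2I x.2).norm ?_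
    exact Eventually.of_forall fun s => norm_indicator_le_norm_self _ _
  rw [splDeriv]
  refine (abs_add_le _ _).trans ?_
  linarith [norm_nonneg x]

lemma splDeriv_sub (x y : Coef) (z : ℝ) : splDeriv (x - y) z = splDeriv x z - splDeriv y z := by
  refine (hasDerivAt_spl (x - y) z).unique ?_
  have : spl (x - y) = spl x - spl y := funext fun z => spl_sub x y z
  rw [this]
  exact (hasDerivAt_spl x z).sub (hasDerivAt_spl y z)

/-- The uniform distance of two elements of `𝒢` and of their derivatives is bounded by the distance
of their coordinates. -/
lemma supDist_le {f g : ℝ → ℝ} (hf : f ∈ spaceG) (hg : g ∈ spaceG) :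
    |supDist f g| ≤ 3 * ‖coef f hf - coef g hg‖ ∧
      |supDist (d1 f) (d1 g)| ≤ 3 * ‖coef f hf - coef g hg‖ := by
  have h0 : ∀ u v : ℝ → ℝ, 0 ≤ supDist u v := fun u v => Real.iSup_nonneg fun z => abs_nonneg _
  rw [abs_of_nonneg (h0 _ _), abs_of_nonneg (h0 _ _)]
  have : Nonempty (Icc (0 : ℝ) 1) := ⟨⟨0, by simp⟩⟩
  refine ⟨ciSup_le fun z => ?_, ciSup_le fun z => ?_⟩
  · rw [← spl_coef hf z.2, ← spl_coef hg z.2, ← spl_sub]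
    exact abs_spl_le _ z.2
  · rw [← d1_congr (spl_coef hf) z.2, ← d1_congr (spl_coef hg) z.2, d1_spl _ z.2, d1_spl _ z.2,
      ← splDeriv_sub]
    exact abs_splDeriv_le _ _

lemma integral_d2_sq {g : ℝ → ℝ} (hg : g ∈ spaceG) :
    ∫ x in (0 : ℝ)..1, d2 g x ^ 2 = ‖(coef g hg).2‖ ^ 2 := by
  rw [← real_inner_self_eq_norm_sq, L2.inner_def, intervalIntegral.integral_of_le zero_le_one,
    ← integral_Icc_eq_integral_Ioc]
  refine integral_congr_ae ?_
  filter_upwards [hg.2.2.coeFn_toLp] with s hs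
  simp only [coef, hs]
  simp [sq]

lemma innerH_eq {g h : ℝ → ℝ} (hg : g ∈ spaceG) (hh : h ∈ spaceG) :
    innerH g h = inner ℝ (coef g hg).2 (coef h hh).2 := by
  rw [innerH, L2.inner_def, intervalIntegral.integral_of_le zero_le_one,
    ← integral_Icc_eq_integral_Ioc]
  refine integral_congr_ae ?_
  filter_upwards [hg.2.2.coeFn_toLp, hh.2.2.coeFn_toLp] with s hs ht
  simp only [coef, hs, ht]
  simp [mul_comm]

lemma coef_spl (x : Coef) : coef (spl x) (spl_mem_spaceG x) = x :=
  spl_injective (spl_coef _)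

/-! ### Tikhonov regularization in Hilbert spaces -/

section Tikhonov

variable {K H L : Type*} [NormedAddCommGroup K] [NormedSpace ℝ K]
  [NormedAddCommGroup H] [InnerProductSpace ℝ H] [NormedAddCommGroup L] [InnerProductSpace ℝ L]

/-- Stability of penalized least squares. Here `xh` solves the normal equations of the perturbed
operator `Sh` with data `Sh x₀ + U`, and `d` is the bias of the unperturbed problem. Both the
perturbation of the operator and the noise `U` contribute an error of order `D / √lam`, because
`S d` is of order `√lam`. -/
lemma norm_sub_le_of_normal_equations (S Sh : K →ₗ[ℝ] L) (pen : K →ₗ[ℝ] H) {c D lam m r : ℝ}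
    (hc : 0 < c) (hD : 0 ≤ D) (hlam : 0 < lam) (hlam1 : lam ≤ 1) (hcD : c * D ≤ 1 / 2)
    (hm : 0 ≤ m) (hr : 0 ≤ r)
    (hSh : ∀ x, ‖Sh x - S x‖ ≤ D * ‖x‖) (hcoer : ∀ x, ‖x‖ ≤ c * (‖S x‖ + ‖pen x‖))
    {d x₀ xh : K} {U : L} (hU : ‖U‖ ≤ D) (hSd : ‖S d‖ ≤ √lam * r) (hd : ‖d‖ ≤ m)
    (hbias : ∀ x, inner ℝ (S d) (S x) + lam * inner ℝ (pen d) (pen x) =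
      -lam * inner ℝ (pen x₀) (pen x))
    (hest : ∀ x, inner ℝ (U - Sh (xh - x₀)) (Sh x) = lam * inner ℝ (pen xh) (pen x)) :
    ‖xh - x₀‖ ≤ ‖d‖ + 4 * c * (1 + m + 2 * c * r) * (D / √lam) := by
  obtain ⟨e, rfl⟩ : ∃ e, xh = e + d + x₀ := ⟨xh - x₀ - d, by abel⟩
  rw [add_sub_cancel_right] at *
  have hs0 : 0 < √lam := Real.sqrt_pos.2 hlam
  have hs1 : √lam ≤ 1 := by rw [← Real.sqrt_one]; exact Real.sqrt_le_sqrt hlam1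
  have hss : √lam * √lam = lam := Real.mul_self_sqrt hlam.le
  set a := ‖Sh e‖ with ha
  set b := ‖pen e‖ with hb
  have ha0 : 0 ≤ a := norm_nonneg _
  have hb0 : 0 ≤ b := norm_nonneg _
  -- the coercivity estimate for `S` is inherited by `Sh`
  have he : ‖e‖ ≤ 2 * c * (a + b) := by
    have h1 : ‖S e‖ ≤ a + D * ‖e‖ := by
      have := norm_sub_norm_le (S e) (Sh e)
      rw [norm_sub_rev] at this
      linarith [hSh e]
    have h2 := hcoer e
    have h3 : c * (‖S e‖ + ‖pen e‖) ≤ c * (a + D * ‖e‖ + b) := by gcongr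
    have h4 : c * D * ‖e‖ ≤ 1 / 2 * ‖e‖ := by gcongr
    nlinarith
  -- the difference of the two normal equations, tested with `e`
  have key : a ^ 2 + lam * b ^ 2 =
      inner ℝ U (Sh e) - inner ℝ (Sh d - S d) (Sh e) - inner ℝ (S d) (Sh e - S e) := by
    have h1 := hest e
    have h2 := hbias e
    rw [ha, hb, ← real_inner_self_eq_norm_sq, ← real_inner_self_eq_norm_sq]
    simp only [map_add, inner_sub_left, inner_add_left, inner_sub_right] at h1 ⊢
    linarith
  have h1 : inner ℝ U (Sh e) ≤ D * a := (real_inner_le_norm _ _).trans (by gcongr)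
  have h2 : -inner ℝ (Sh d - S d) (Sh e) ≤ D * m * a := by
    refine (neg_le_abs _).trans ((abs_real_inner_le_norm _ _).trans ?_)
    gcongr
    exact (hSh d).trans (by gcongr)
  have h3 : -inner ℝ (S d) (Sh e - S e) ≤ √lam * r * (D * (2 * c * (a + b))) := by
    refine (neg_le_abs _).trans ((abs_real_inner_le_norm _ _).trans ?_)
    gcongr
    exact (hSh e).trans (by gcongr)
  have h4 : √lam * r * (D * (2 * c * (a + b))) ≤ D * (2 * c * r) * (a + √lam * b) := by
    have : √lam * a ≤ a := mul_le_of_le_one_left ha0 hs1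
    have h5 : 0 ≤ D * (2 * c * r) := by positivity
    nlinarith
  set C := 1 + m + 2 * c * r with hC
  have hC0 : 0 ≤ C := by positivity
  set s := √lam * b with hs
  have hs2 : lam * b ^ 2 = s ^ 2 := by rw [hs, mul_pow, Real.sq_sqrt hlam.le]
  have hsn : 0 ≤ s := by positivity
  have h5 : a ^ 2 + s ^ 2 ≤ C * D * (a + s) := by
    have h6 : D * a + D * m * a ≤ D * (1 + m) * (a + s) := by
      have : 0 ≤ D * (1 + m) * s := by positivity
      nlinarith
    rw [← hs2, key, hC]
    nlinarith
  have h6 : a + s ≤ 2 * (C * D) := by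
    by_contra! hcon
    have : 0 ≤ C * D := by positivity
    nlinarith [sq_nonneg (a - s)]
  have h7 : a + b ≤ 2 * (C * D) / √lam := by
    rw [le_div_iff₀ hs0]
    have : a * √lam ≤ a := mul_le_of_le_one_right ha0 hs1
    have : b * √lam = s := mul_comm _ _
    linarith
  calc ‖e + d‖ ≤ ‖d‖ + ‖e‖ := by rw [add_comm]; exact norm_add_le _ _
    _ ≤ ‖d‖ + 2 * c * (2 * (C * D) / √lam) := by
        gcongr
        exact he.trans (by gcongr)
    _ = _ := by ring

/-- A minimizer of a penalized least squares criterion satisfies the normal equations. -/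
lemma normal_equations_of_isMin (Sh : K →ₗ[ℝ] L) (pen : K →ₗ[ℝ] H) {lam : ℝ} {y : L} {xh : K}
    (hmin : ∀ x, ‖y - Sh xh‖ ^ 2 + lam * ‖pen xh‖ ^ 2 ≤ ‖y - Sh x‖ ^ 2 + lam * ‖pen x‖ ^ 2)
    (x : K) : inner ℝ (y - Sh xh) (Sh x) = lam * inner ℝ (pen xh) (pen x) := by
  have h : ∀ t : ℝ, 0 ≤ t * (2 * (lam * inner ℝ (pen xh) (pen x) - inner ℝ (y - Sh xh) (Sh x))) +
      t ^ 2 * (‖Sh x‖ ^ 2 + lam * ‖pen x‖ ^ 2) := by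
    intro t
    have h1 := hmin (xh + t • x)
    have e1 : y - Sh (xh + t • x) = (y - Sh xh) - t • Sh x := by
      simp only [map_add, map_smul]; abel
    have e2 : pen (xh + t • x) = pen xh + t • pen x := by simp
    rw [e1, e2, norm_sub_sq_real (y - Sh xh), norm_add_sq_real, inner_smul_right, inner_smul_right,
      norm_smul, norm_smul, mul_pow, mul_pow, Real.norm_eq_abs, sq_abs] at h1
    linarith
  set p := 2 * (lam * inner ℝ (pen xh) (pen x) - inner ℝ (y - Sh xh) (Sh x)) with hp
  set q := ‖Sh x‖ ^ 2 + lam * ‖pen x‖ ^ 2 with hq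
  have hp0 : p = 0 := by
    by_contra hne
    have hp2 : 0 < p ^ 2 := by positivity
    have hden : 0 < 1 + |q| := by positivity
    have h1 := h (-p / (1 + |q|))
    have h2 : -p / (1 + |q|) * p + (-p / (1 + |q|)) ^ 2 * q =
        p ^ 2 / (1 + |q|) ^ 2 * (q - (1 + |q|)) := by
      field_simp
      ring
    rw [h2] at h1
    have h3 : 0 < p ^ 2 / (1 + |q|) ^ 2 := by positivity
    nlinarith [le_abs_self q]
  linarith

/-- `k` is the bias of Tikhonov regularization of `T h = T h₀`: the difference of the regularized
solution and `h₀`, that is, `k = -lam (lam + T* T)⁻¹ h₀`, in weak form. -/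
def IsTikhonovBias (T : H →L[ℝ] L) (lam : ℝ) (h₀ k : H) : Prop :=
  ∀ h, inner ℝ (T k) (T h) + lam * inner ℝ k h = -lam * inner ℝ h₀ h

lemma exists_isTikhonovBias [CompleteSpace H] (T : H →L[ℝ] L) {lam : ℝ} (hlam : 0 < lam) (h₀ : H) :
    ∃ k, IsTikhonovBias T lam h₀ k := by
  let B : H →L[ℝ] H →L[ℝ] ℝ := (innerSL ℝ).bilinearComp T T + lam • innerSL ℝ
  have hB : ∀ v w, B v w = inner ℝ (T v) (T w) + lam * inner ℝ v w := fun v w => rfl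
  have hco : IsCoercive B := by
    refine ⟨lam, hlam, fun u => ?_⟩
    rw [hB, real_inner_self_eq_norm_sq, real_inner_self_eq_norm_sq]
    nlinarith [sq_nonneg ‖T u‖]
  refine ⟨hco.continuousLinearEquivOfBilin.symm (-lam • h₀), fun h => ?_⟩
  rw [← hB, ← hco.continuousLinearEquivOfBilin_apply, ContinuousLinearEquiv.apply_symm_apply,
    inner_smul_left]
  simp

lemma IsTikhonovBias.norm_le {T : H →L[ℝ] L} {lam : ℝ} (hlam : 0 < lam) {h₀ k : H}
    (hk : IsTikhonovBias T lam h₀ k) : ‖k‖ ≤ ‖h₀‖ ∧ ‖T k‖ ≤ √lam * ‖h₀‖ := by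
  have h1 := hk k
  rw [real_inner_self_eq_norm_sq, real_inner_self_eq_norm_sq] at h1
  have h2 := (neg_le_abs _).trans (abs_real_inner_le_norm h₀ k)
  have h3 : ‖k‖ ≤ ‖h₀‖ := by
    by_contra! hcon
    have h4 : 0 < ‖k‖ := (norm_nonneg _).trans_lt hcon
    have h5 : ‖h₀‖ * ‖k‖ < ‖k‖ ^ 2 := by nlinarith
    nlinarith [sq_nonneg ‖T k‖]
  refine ⟨h3, ?_⟩
  refine abs_le_of_sq_le_sq' ?_ (by positivity) |>.2
  rw [mul_pow, Real.sq_sqrt hlam.le]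
  have h4 : ‖h₀‖ * ‖k‖ ≤ ‖h₀‖ ^ 2 := by nlinarith [norm_nonneg h₀]
  nlinarith [sq_nonneg ‖k‖, mul_le_mul_of_nonneg_left (h2.trans h4) hlam.le]

/-- The bias vanishes in the limit if `T` is injective: then the range of `T*` is dense, and for
`h₀ = T* v` the bias is of order `√lam`. -/
lemma tendsto_tikhonovBias [CompleteSpace H] [CompleteSpace L] (T : H →L[ℝ] L)
    (hT : Function.Injective T) {lam : ℕ → ℝ} (hpos : ∀ n, 0 < lam n)
    (hlam : Tendsto lam atTop (𝓝 0)) {h₀ : H} {k : ℕ → H}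
    (hk : ∀ n, IsTikhonovBias T (lam n) h₀ (k n)) : Tendsto (fun n => ‖k n‖) atTop (𝓝 0) := by
  have hdense : DenseRange T.adjoint := by
    have h1 : (T.adjoint.range)ᗮ = ⊥ := by
      rw [Submodule.eq_bot_iff]
      intro h hh
      refine hT ?_
      rw [map_zero, ← inner_self_eq_zero (𝕜 := ℝ), ← ContinuousLinearMap.adjoint_inner_left]
      exact hh _ ⟨T h, rfl⟩
    have h2 := (Submodule.topologicalClosure_eq_top_iff).2 h1
    rw [Submodule.dense_iff_topologicalClosure_eq_top.symm] at h2
    exact h2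
  rw [Metric.tendsto_atTop]
  intro ε hε
  obtain ⟨v, hv⟩ := hdense.exists_dist_lt h₀ (half_pos hε)
  rw [dist_eq_norm] at hv
  have h1 : Tendsto (fun n => lam n * ‖v‖ ^ 2 / 4) atTop (𝓝 0) := by
    simpa using (hlam.mul_const (‖v‖ ^ 2)).div_const 4
  obtain ⟨N, hN⟩ := eventually_atTop.1
    (h1.eventually (gt_mem_nhds (show 0 < ε ^ 2 / 2 by positivity)))
  refine ⟨N, fun n hn => ?_⟩
  rw [Real.dist_eq, sub_zero, abs_norm]
  have h2 := hk n (k n)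
  have h3 : inner ℝ h₀ (k n) = inner ℝ (h₀ - T.adjoint v) (k n) + inner ℝ v (T (k n)) := by
    rw [inner_sub_left, ContinuousLinearMap.adjoint_inner_left]
    ring
  rw [h3, real_inner_self_eq_norm_sq, real_inner_self_eq_norm_sq] at h2
  have h4 : -inner ℝ (h₀ - T.adjoint v) (k n) ≤ ε / 2 * ‖k n‖ :=
    (neg_le_abs _).trans ((abs_real_inner_le_norm _ _).trans (by gcongr))
  have h5 : -inner ℝ v (T (k n)) ≤ ‖v‖ * ‖T (k n)‖ :=
    (neg_le_abs _).trans (abs_real_inner_le_norm _ _)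
  have h6 := hpos n
  have h7 : lam n * (‖v‖ * ‖T (k n)‖) ≤ lam n * (lam n * ‖v‖ ^ 2 / 4) + ‖T (k n)‖ ^ 2 := by
    nlinarith [sq_nonneg (lam n * ‖v‖ / 2 - ‖T (k n)‖)]
  have h8 : ‖k n‖ ^ 2 ≤ ε / 2 * ‖k n‖ + lam n * ‖v‖ ^ 2 / 4 := by
    refine le_of_mul_le_mul_left ?_ h6
    nlinarith [mul_le_mul_of_nonneg_left h4 h6.le, mul_le_mul_of_nonneg_left h5 h6.le]
  have h9 := hN n hn
  by_contra! hcon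
  nlinarith

/-- The elementary spectral estimate behind the rate of Tikhonov regularization; the minimum is the
saturation of the method. -/
lemma tikhonov_filter_le {lam s b g : ℝ} (hlam : 0 < lam) (hs : 0 < s) (hsb : s ≤ b) (hg : 0 < g) :
    lam / (lam + s ^ 2) * s ^ g ≤ b ^ (g - min g 2) * lam ^ (min g 2 / 2) := by
  set m := min g 2 with hm
  have hm0 : 0 < m := lt_min hg two_pos
  have hmg : m ≤ g := min_le_left _ _
  have hm2 : m ≤ 2 := min_le_right _ _
  have h1 : s ^ g ≤ b ^ (g - m) * s ^ m := by
    have : s ^ g = s ^ (g - m) * s ^ m := by rw [← Real.rpow_add hs]; ring_nf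
    rw [this]
    gcongr
  have h2 : lam * s ^ m ≤ lam ^ (m / 2) * (lam + s ^ 2) := by
    have h3 := Real.geom_mean_le_arith_mean2_weighted (w₁ := 1 - m / 2) (w₂ := m / 2)
      (p₁ := lam) (p₂ := s ^ 2) (by linarith) (by linarith) hlam.le (by positivity) (by ring)
    have h4 : (s ^ 2) ^ (m / 2) = s ^ m := by
      rw [← Real.rpow_natCast, ← Real.rpow_mul hs.le]
      congr 1
      push_cast
      ring
    rw [h4] at h3
    have h5 : lam = lam ^ (m / 2) * lam ^ (1 - m / 2) := by
      rw [← Real.rpow_add hlam]; simp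
    have h6 : (1 - m / 2) * lam + m / 2 * s ^ 2 ≤ lam + s ^ 2 := by
      nlinarith [sq_nonneg s]
    calc lam * s ^ m = lam ^ (m / 2) * (lam ^ (1 - m / 2) * s ^ m) := by
          rw [← mul_assoc, ← h5]
      _ ≤ lam ^ (m / 2) * (lam + s ^ 2) := by
          gcongr
          exact h3.trans h6
  have hden : 0 < lam + s ^ 2 := by positivity
  rw [div_mul_eq_mul_div, div_le_iff₀ hden]
  have hb : 0 < b := hs.trans_le hsb
  calc lam * s ^ g ≤ lam * (b ^ (g - m) * s ^ m) := by gcongr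
    _ = b ^ (g - m) * (lam * s ^ m) := by ring
    _ ≤ b ^ (g - m) * (lam ^ (m / 2) * (lam + s ^ 2)) := by gcongr
    _ = _ := by ring

/-- Under a source condition, the bias of Tikhonov regularization decreases polynomially. -/
lemma exists_tikhonovBias_le [CompleteSpace H] (T : H →L[ℝ] L) {s : ℕ → ℝ} {φ : ℕ → H} {ψ : ℕ → L}
    (hs : ∀ j, 0 < s j) (hφ : Orthonormal ℝ φ) (hφc : ∀ h, (∀ j, inner ℝ h (φ j) = 0) → h = 0)
    (hψ : Orthonormal ℝ ψ) (hmap : ∀ j, T (φ j) = s j • ψ j)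
    (hadj : ∀ j h, inner ℝ (T h) (ψ j) = s j * inner ℝ h (φ j)) {h₀ : H} {g : ℝ} (hg : 0 < g)
    (hsum : Summable fun j => s j ^ (-(2 * g)) * inner ℝ h₀ (φ j) ^ 2) :
    ∃ C, ∀ lam, 0 < lam → ∀ k, IsTikhonovBias T lam h₀ k → ‖k‖ ≤ C * lam ^ (min g 2 / 2) := by
  have hbot : (Submodule.span ℝ (Set.range φ))ᗮ = ⊥ := by
    rw [Submodule.eq_bot_iff]
    intro h hh
    exact hφc h fun j => (Submodule.mem_orthogonal' _ _).1 hh _ (Submodule.subset_span ⟨j, rfl⟩)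
  let b := HilbertBasis.mkOfOrthogonalEqBot hφ hbot
  have hb : ∀ j, b j = φ j := fun j => by
    rw [show b j = (⇑b) j from rfl, HilbertBasis.coe_mkOfOrthogonalEqBot]
  have hsT : ∀ j, s j ≤ ‖T‖ := by
    intro j
    have h1 := T.le_opNorm (φ j)
    rw [hmap, norm_smul, hψ.1, hφ.1, mul_one, mul_one, Real.norm_eq_abs, abs_of_pos (hs j)] at h1
    exact h1
  set C₀ := ‖T‖ ^ (g - min g 2) with hC₀
  set A := ∑' j, s j ^ (-(2 * g)) * inner ℝ h₀ (φ j) ^ 2 with hA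
  have hC₀0 : 0 ≤ C₀ := Real.rpow_nonneg (norm_nonneg _) _
  refine ⟨C₀ * √A, fun lam hlam k hk => ?_⟩
  have hcoef : ∀ j, inner ℝ k (φ j) ^ 2 ≤
      (C₀ * lam ^ (min g 2 / 2)) ^ 2 * (s j ^ (-(2 * g)) * inner ℝ h₀ (φ j) ^ 2) := by
    intro j
    have h1 := hk (φ j)
    rw [hmap, inner_smul_right, hadj] at h1
    have hden : 0 < lam + s j ^ 2 := by have := hs j; positivity
    have h2 : inner ℝ k (φ j) = -(lam / (lam + s j ^ 2)) * inner ℝ h₀ (φ j) := by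
      field_simp
      linarith
    have h3 := tikhonov_filter_le hlam (hs j) (hsT j) hg
    have h4 : (s j ^ g) ^ 2 * s j ^ (-(2 * g)) = 1 := by
      rw [← Real.rpow_natCast, ← Real.rpow_mul (hs j).le, ← Real.rpow_add (hs j)]
      have : g * ((2 : ℕ) : ℝ) + -(2 * g) = 0 := by push_cast; ring
      rw [this, Real.rpow_zero]
    have h5 : inner ℝ k (φ j) ^ 2 = (lam / (lam + s j ^ 2) * s j ^ g) ^ 2 *
        (s j ^ (-(2 * g)) * inner ℝ h₀ (φ j) ^ 2) := by
      rw [h2]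
      linear_combination (lam / (lam + s j ^ 2)) ^ 2 * inner ℝ h₀ (φ j) ^ 2 * (-h4)
    rw [h5]
    have := hs j
    gcongr
  have hP := b.hasSum_inner_mul_inner k k
  have hP2 : HasSum (fun j => inner ℝ k (φ j) ^ 2) (‖k‖ ^ 2) := by
    rw [← real_inner_self_eq_norm_sq]
    refine hP.congr_fun fun j => ?_
    rw [hb, real_inner_comm k, sq]
  have h6 : ‖k‖ ^ 2 ≤ (C₀ * lam ^ (min g 2 / 2)) ^ 2 * A := by
    rw [hA, ← tsum_mul_left]
    exact hP2.tsum_eq ▸ hP2.summable.tsum_le_tsum hcoef (hsum.mul_left _)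
  have hA0 : 0 ≤ A := tsum_nonneg fun j => by
    have := hs j
    positivity
  refine (abs_le_of_sq_le_sq' ?_ (by positivity)).2
  rw [mul_right_comm, mul_pow _ (√A), Real.sq_sqrt hA0]
  exact h6

end Tikhonov

/-! ### Elimination of the unpenalized part -/

section Profile

variable {V H L : Type*} [NormedAddCommGroup V] [NormedSpace ℝ V]
  [NormedAddCommGroup H] [InnerProductSpace ℝ H]
  [NormedAddCommGroup L] [InnerProductSpace ℝ L]

/-- The image under `S` of the unpenalized space `V`. -/
def unpenalizedRange (S : V × H →L[ℝ] L) : Submodule ℝ L :=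
  Submodule.span ℝ (Set.range fun β : V => S (β, 0))

lemma unpenalizedRange_eq (S : V × H →L[ℝ] L) :
    unpenalizedRange S = (S ∘L ContinuousLinearMap.inl ℝ V H).toLinearMap.range := by
  have : (Set.range fun β : V => S (β, 0)) =
      ((S ∘L ContinuousLinearMap.inl ℝ V H).toLinearMap.range : Set L) := by
    ext y
    simp
  rw [unpenalizedRange, this, Submodule.span_eq]

lemma mem_unpenalizedRange {S : V × H →L[ℝ] L} {y : L} :
    y ∈ unpenalizedRange S ↔ ∃ β : V, S (β, 0) = y := by
  rw [unpenalizedRange_eq]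
  simp

variable [FiniteDimensional ℝ V]

instance (S : V × H →L[ℝ] L) : FiniteDimensional ℝ (unpenalizedRange S) := by
  rw [unpenalizedRange_eq]
  infer_instance

/-- The operator on the penalized space `H` that remains when the image of the unpenalized space
`V` is projected out. -/
def profileOp (S : V × H →L[ℝ] L) : H →L[ℝ] L :=
  (unpenalizedRange S)ᗮ.starProjection ∘L S ∘L ContinuousLinearMap.inr ℝ V H

lemma profileOp_apply (S : V × H →L[ℝ] L) (h : H) :
    profileOp S h = S (0, h) - (unpenalizedRange S).starProjection (S (0, h)) := by
  simp [profileOp]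

lemma profileOp_injective {S : V × H →L[ℝ] L} (hS : Function.Injective S) :
    Function.Injective (profileOp S) := by
  rw [injective_iff_map_eq_zero]
  intro h hh
  rw [profileOp_apply, sub_eq_zero] at hh
  have hmem := Submodule.starProjection_apply_mem (unpenalizedRange S) (S (0, h))
  rw [← hh] at hmem
  obtain ⟨β, hβ⟩ := mem_unpenalizedRange.1 hmem
  have := hS hβ
  exact (congrArg Prod.snd this).symm

/-- An injective operator is bounded below on the unpenalized space, which has finite dimension; so
the penalty is only needed to control the penalized part. -/
lemma exists_norm_le_of_injective {S : V × H →L[ℝ] L} (hS : Function.Injective S) :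
    ∃ c, 0 < c ∧ ∀ x, ‖x‖ ≤ c * (‖S x‖ + ‖x.2‖) := by
  have hinj : (S ∘L ContinuousLinearMap.inl ℝ V H).toLinearMap.ker = ⊥ := by
    rw [LinearMap.ker_eq_bot]
    intro a b hab
    exact congrArg Prod.fst (hS hab)
  obtain ⟨K, hK, hanti⟩ := LinearMap.exists_antilipschitzWith _ hinj
  have hV : ∀ β : V, ‖β‖ ≤ K * ‖S (β, 0)‖ := fun β => by
    have := hanti.le_mul_dist β 0
    rwa [map_zero, dist_zero_right, dist_zero_right] at this
  refine ⟨K * (1 + ‖S‖) + 1, by positivity, fun x => ?_⟩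
  have h1 : ‖S (x.1, 0)‖ ≤ ‖S x‖ + ‖S‖ * ‖x.2‖ := by
    have e : S (x.1, 0) = S x - S (0, x.2) := by
      rw [← map_sub]
      congr 1
      ext <;> simp
    rw [e]
    refine (norm_sub_le _ _).trans ?_
    gcongr
    refine (S.le_opNorm _).trans ?_
    gcongr
    simp
  have h2 : ‖x.1‖ ≤ K * (‖S x‖ + ‖S‖ * ‖x.2‖) := (hV x.1).trans (by gcongr)
  have h3 : 0 ≤ (K : ℝ) * ‖S‖ * ‖S x‖ := by positivity
  have h4 : 0 ≤ (K : ℝ) * ‖x.2‖ := by positivity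
  rw [Prod.norm_def]
  refine max_le ?_ ?_
  · nlinarith [norm_nonneg (S x), norm_nonneg x.2]
  · have h5 : 0 ≤ (K : ℝ) * (1 + ‖S‖) * (‖S x‖ + ‖x.2‖) := by positivity
    nlinarith [norm_nonneg (S x)]

/-- Completing the bias of the profiled problem by the optimal unpenalized part gives the bias of
the full problem. -/
lemma exists_full_bias {S : V × H →L[ℝ] L} (hS : Function.Injective S) :
    ∃ C, 0 ≤ C ∧ ∀ lam h₀ k, IsTikhonovBias (profileOp S) lam h₀ k →
      ∃ d : V × H, d.2 = k ∧ S d = profileOp S k ∧ ‖d‖ ≤ C * ‖k‖ ∧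
        ∀ x : V × H, inner ℝ (S d) (S x) + lam * inner ℝ d.2 x.2 = -lam * inner ℝ h₀ x.2 := by
  obtain ⟨c, hc, hcoer⟩ := exists_norm_le_of_injective hS
  refine ⟨c * (‖profileOp S‖ + 1), by positivity, fun lam h₀ k hk => ?_⟩
  obtain ⟨β, hβ⟩ := mem_unpenalizedRange.1
    (Submodule.starProjection_apply_mem (unpenalizedRange S) (S (0, k)))
  have hSd : S (-β, k) = profileOp S k := by
    rw [profileOp_apply, ← hβ, ← map_sub]
    simp
  refine ⟨(-β, k), rfl, hSd, ?_, fun x => ?_⟩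
  · refine (hcoer _).trans ?_
    rw [hSd, mul_assoc, add_mul, one_mul]
    gcongr
    exact (profileOp S).le_opNorm k
  · rw [hSd]
    have horth : ∀ y ∈ unpenalizedRange S, inner ℝ (profileOp S k) y = 0 := fun y hy =>
      (Submodule.mem_orthogonal' _ _).1
        (Submodule.starProjection_apply_mem (unpenalizedRange S)ᗮ _) y hy
    have e : S x = S (x.1, 0) + (profileOp S x.2 +
        (unpenalizedRange S).starProjection (S (0, x.2))) := by
      rw [profileOp_apply, sub_add_cancel, ← map_add]
      simp
    rw [e, inner_add_right, inner_add_right, horth _ (mem_unpenalizedRange.2 ⟨_, rfl⟩),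
      horth _ (Submodule.starProjection_apply_mem _ _), ← hk x.2]
    ring

end Profile

/-! ### Exponential moments -/

section Moments

variable {Ω : Type*} [MeasurableSpace Ω] {p : ℕ}

lemma enorm_sq_Lp {α F : Type*} [MeasurableSpace α] [NormedAddCommGroup F] {μ : Measure α}
    (f : Lp F 2 μ) : ‖f‖ₑ ^ 2 = ∫⁻ t, ‖f t‖ₑ ^ 2 ∂μ := by
  rw [Lp.enorm_def, eLpNorm_eq_lintegral_rpow_enorm_toReal (by norm_num) (by norm_num)]
  simp only [ENNReal.toReal_ofNat, one_div]
  rw [← ENNReal.rpow_natCast, ← ENNReal.rpow_mul]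
  norm_num

lemma norm_sq_Lp {μ : Measure (E p)} (f : Lp ℂ 2 μ) : ‖f‖ ^ 2 = ∫ t, ‖f t‖ ^ 2 ∂μ := by
  rw [← real_inner_self_eq_norm_sq, L2.inner_def]
  simp only [real_inner_self_eq_norm_sq]

lemma measurable_expi_comp {W : Ω → E p} (hW : Measurable W) (t : E p) :
    Measurable fun ω => expi (W ω) t :=
  (continuous_expi.comp (Continuous.prodMk_left t)).measurable.comp hW

lemma integrable_mul_expi {P : Measure Ω} {W : Ω → E p} (hW : Measurable W) {f : Ω → ℝ}
    (hf : Integrable f P) (t : E p) : Integrable (fun ω => (f ω : ℂ) * expi (W ω) t) P :=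
  hf.ofReal.mul_bdd (c := 1) (measurable_expi_comp hW t).aestronglyMeasurable
    (Eventually.of_forall fun _ => (norm_expi _ _).le)

lemma continuous_expMoment {P : Measure Ω} {W : Ω → E p} (hW : Measurable W) {f : Ω → ℝ}
    (hf : Integrable f P) : Continuous (expMoment P W f) := by
  unfold expMoment
  refine continuous_of_dominated (bound := fun ω => ‖f ω‖) ?_ ?_ hf.norm ?_
  · exact fun t => (integrable_mul_expi hW hf t).aestronglyMeasurable
  · exact fun t => Eventually.of_forall fun ω => by simp [norm_expi]
  · exact Eventually.of_forall fun ω =>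
      continuous_const.mul (continuous_expi.comp (Continuous.prodMk_right (W ω)))

lemma expMoment_congr {P : Measure Ω} {W : Ω → E p} {f g : Ω → ℝ} (h : f =ᵐ[P] g) :
    expMoment P W f = expMoment P W g := by
  funext t
  refine integral_congr_ae ?_
  filter_upwards [h] with ω hω
  rw [hω]

lemma expMoment_add {P : Measure Ω} {W : Ω → E p} (hW : Measurable W) {f g : Ω → ℝ}
    (hf : Integrable f P) (hg : Integrable g P) (t : E p) :
    expMoment P W (fun ω => f ω + g ω) t = expMoment P W f t + expMoment P W g t := by
  unfold expMoment
  rw [← integral_add (integrable_mul_expi hW hf t) (integrable_mul_expi hW hg t)]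
  congr 1
  funext ω
  push_cast
  ring

lemma expMoment_const_mul (P : Measure Ω) (W : Ω → E p) (f : Ω → ℝ) (c : ℝ) (t : E p) :
    expMoment P W (fun ω => c * f ω) t = c * expMoment P W f t := by
  unfold expMoment
  rw [← integral_const_mul]
  congr 1
  funext ω
  push_cast
  ring

lemma coeFn_expMomentLp (P : Measure Ω) (μ : Measure (E p)) [IsProbabilityMeasure μ] {W : Ω → E p}
    (hW : Measurable W) (f : Ω → ℝ) : expMomentLp P μ hW f =ᵐ[μ] expMoment P W f :=
  MemLp.coeFn_toLp _

/-- If all exponential moments of `f` vanish, then the positive and the negative part of `f` induce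
measures with the same characteristic function on the space of `W`, so that `𝔼[f | W] = 0`. -/
lemma condExp_eq_zero_of_expMoment {P : Measure Ω} [IsProbabilityMeasure P] {W : Ω → E p}
    (hW : Measurable W) {f : Ω → ℝ} (hf : Integrable f P) (h : ∀ t, expMoment P W f t = 0) :
    P[f | MeasurableSpace.comap W inferInstance] =ᵐ[P] 0 := by
  have hfin : ∀ {g : Ω → ℝ}, Integrable g P →
      IsFiniteMeasure (P.withDensity fun ω => ENNReal.ofReal (g ω)) := fun hg =>
    isFiniteMeasure_withDensity_ofReal hg.2
  have := hfin hf
  have := hfin hf.neg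
  let ν : (Ω → ℝ) → Measure (E p) := fun g =>
    (P.withDensity fun ω => ENNReal.ofReal (g ω)).map W
  have hchar : ∀ {g : Ω → ℝ}, Integrable g P → ∀ t, charFun (ν g) t =
      expMoment P W (fun ω => max (g ω) 0) t := by
    intro g hg t
    rw [charFun_apply, integral_map hW.aemeasurable (Continuous.aestronglyMeasurable (by fun_prop)),
      integral_withDensity_eq_integral_toReal_smul₀ hg.aemeasurable.ennreal_ofReal
        (Eventually.of_forall fun _ => ENNReal.ofReal_lt_top)]
    refine integral_congr_ae (Eventually.of_forall fun ω => ?_)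
    simp only [expi, ENNReal.toReal_ofReal', Complex.real_smul, mul_comm Complex.I]
  have hν : ν f = ν (-f) := by
    refine Measure.ext_of_charFun (funext fun t => ?_)
    rw [hchar hf, hchar hf.neg, ← sub_eq_zero, ← h t]
    unfold expMoment
    refine (integral_sub (integrable_mul_expi hW hf.pos_part t)
      (integrable_mul_expi hW hf.neg_part t)).symm.trans ?_
    congr 1
    funext ω
    rw [← sub_mul, ← Complex.ofReal_sub, max_zero_sub_eq_self]
  symm
  refine ae_eq_condExp_of_forall_setIntegral_eq hW.comap_le hf
    (fun s _ _ => (integrable_zero _ _ _).integrableOn) ?_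
    stronglyMeasurable_zero.aestronglyMeasurable
  rintro s ⟨B, hB, rfl⟩ -
  have hmass : ∀ g : Ω → ℝ, ν g B = ∫⁻ ω in W ⁻¹' B, ENNReal.ofReal (g ω) ∂P := fun g => by
    simp only [ν]
    rw [Measure.map_apply hW hB, withDensity_apply _ (hW hB)]
  rw [integral_eq_lintegral_pos_part_sub_lintegral_neg_part hf.integrableOn, ← hmass f]
  have := hmass (-f)
  simp only [Pi.neg_apply] at this
  rw [← this, hν]
  simp

lemma expMoment_eq_zero_of_condExp {P : Measure Ω} [IsProbabilityMeasure P] {W : Ω → E p}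
    (hW : Measurable W) {f : Ω → ℝ} (hf : Integrable f P)
    (h : P[f | MeasurableSpace.comap W inferInstance] =ᵐ[P] 0) (t : E p) :
    expMoment P W f t = 0 := by
  have hreal : ∀ v : E p → ℝ, Continuous v → (∀ w, |v w| ≤ 1) → ∫ ω, f ω * v (W ω) ∂P = 0 := by
    intro v hv hb
    have hvm : StronglyMeasurable[MeasurableSpace.comap W inferInstance] fun ω => v (W ω) :=
      (hv.measurable.comp (comap_measurable W)).stronglyMeasurable
    have hint : Integrable (f * fun ω => v (W ω)) P :=
      hf.mul_bdd (c := 1) (hv.measurable.comp hW).aestronglyMeasurable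
        (Eventually.of_forall fun ω => hb _)
    have h1 := condExp_mul_of_stronglyMeasurable_right hvm hint hf
    have h2 := integral_condExp hW.comap_le (f := f * fun ω => v (W ω)) (μ := P)
    rw [integral_congr_ae (h1.trans (h.mul (ae_eq_refl _)))] at h2
    simpa using h2.symm
  have hi := integrable_mul_expi hW hf t
  have hc : Continuous fun w : E p => expi w t := continuous_expi.comp (Continuous.prodMk_left t)
  refine Complex.ext ?_ ?_
  · have := hreal (fun w => (expi w t).re) (Complex.continuous_re.comp hc) fun w =>
      (Complex.abs_re_le_norm _).trans (norm_expi _ _).le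
    rw [expMoment, ← RCLike.re_eq_complex_re, ← integral_re hi]
    simpa using this
  · have := hreal (fun w => (expi w t).im) (Complex.continuous_im.comp hc) fun w =>
      (Complex.abs_im_le_norm _).trans (norm_expi _ _).le
    rw [expMoment, ← RCLike.im_eq_complex_im, ← integral_im hi]
    simpa using this

lemma isOpenPosMeasure_of_support_eq_univ {μ : Measure (E p)} (h : μ.support = univ) :
    μ.IsOpenPosMeasure := by
  refine ⟨fun U hU ⟨x, hx⟩ => ?_⟩
  have hx' : x ∈ μ.support := h ▸ mem_univ x
  exact ((μ.mem_support_iff_forall x).1 hx' U (hU.mem_nhds hx)).ne'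

end Moments

/-! ### The population operator -/

section Population

variable {Ω : Type*} [MeasurableSpace Ω] {p : ℕ}

lemma memLp_spl {P : Measure Ω} [IsProbabilityMeasure P] {Z : Ω → ℝ} (hZ : Measurable Z)
    (hZI : ∀ᵐ ω ∂P, Z ω ∈ Icc (0 : ℝ) 1) (x : Coef) (q : ℝ≥0∞) :
    MemLp (fun ω => spl x (Z ω)) q P := by
  refine MemLp.of_bound ((continuous_spl x).measurable.comp hZ).aestronglyMeasurable (3 * ‖x‖) ?_
  filter_upwards [hZI] with ω hω
  exact abs_spl_le x hω

variable (P : Measure Ω) [IsProbabilityMeasure P] (μ : Measure (E p)) [IsProbabilityMeasure μ]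
  {Z : Ω → ℝ} (hZ : Measurable Z) (hZI : ∀ᵐ ω ∂P, Z ω ∈ Icc (0 : ℝ) 1)
  {W : Ω → E p} (hW : Measurable W)

/-- The operator `g ↦ 𝔼[g(Z) exp(i Wᵀ ·)]` in the coordinates of the spline space. -/
def opS : Coef →L[ℝ] Lp ℂ 2 μ :=
  LinearMap.mkContinuous
    { toFun := fun x => expMomentLp P μ hW fun ω => spl x (Z ω)
      map_add' := fun x y => by
        refine Lp.ext ?_
        filter_upwards [coeFn_expMomentLp P μ hW fun ω => spl (x + y) (Z ω),
          coeFn_expMomentLp P μ hW fun ω => spl x (Z ω),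
          coeFn_expMomentLp P μ hW fun ω => spl y (Z ω),
          Lp.coeFn_add (expMomentLp P μ hW fun ω => spl x (Z ω))
            (expMomentLp P μ hW fun ω => spl y (Z ω))] with t h1 h2 h3 h4
        rw [h1, h4, Pi.add_apply, h2, h3]
        simp only [spl_add]
        exact expMoment_add hW (memLp_one_iff_integrable.1 (memLp_spl hZ hZI x 1))
          (memLp_one_iff_integrable.1 (memLp_spl hZ hZI y 1)) t
      map_smul' := fun c x => by
        refine Lp.ext ?_
        filter_upwards [coeFn_expMomentLp P μ hW fun ω => spl (c • x) (Z ω),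
          coeFn_expMomentLp P μ hW fun ω => spl x (Z ω),
          Lp.coeFn_smul c (expMomentLp P μ hW fun ω => spl x (Z ω))] with t h1 h2 h3
        rw [RingHom.id_apply, h1, h3, Pi.smul_apply, h2, Complex.real_smul]
        simp only [spl_smul]
        exact expMoment_const_mul P W _ c t } 3 <| by
    intro x
    refine (Lp.norm_le_of_ae_bound (C := 3 * ‖x‖) (by positivity) ?_).trans_eq ?_
    · filter_upwards [coeFn_expMomentLp P μ hW fun ω => spl x (Z ω)] with t ht
      refine (congrArg norm ht).trans_le ?_
      refine (norm_integral_le_of_norm_le_const (C := 3 * ‖x‖) ?_).trans_eq (by simp)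
      filter_upwards [hZI] with ω hω
      rw [norm_mul, norm_expi, mul_one, Complex.norm_real]
      exact abs_spl_le x hω
    · have : measureUnivNNReal μ = 1 := by simp [measureUnivNNReal]
      simp [this]

lemma opS_apply (x : Coef) :
    opS P μ hZ hZI hW x = expMomentLp P μ hW fun ω => spl x (Z ω) := rfl

/-- Completeness makes the operator injective: the exponential moments, which vanish on a dense set
since `μ` has full support, determine the conditional expectation. -/
lemma opS_injective (hμ : μ.support = univ)
    (hcomplete : ∀ g₁ ∈ spaceG, ∀ g₂ ∈ spaceG,
      P[fun ω => g₁ (Z ω) | MeasurableSpace.comap W inferInstance] =ᵐ[P]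
        P[fun ω => g₂ (Z ω) | MeasurableSpace.comap W inferInstance] →
      EqOn g₁ g₂ (Icc 0 1)) : Function.Injective (opS P μ hZ hZI hW) := by
  rw [injective_iff_map_eq_zero]
  intro x hx
  have hint := memLp_one_iff_integrable.1 (memLp_spl hZ hZI x 1)
  have := isOpenPosMeasure_of_support_eq_univ hμ
  have h0 : expMoment P W (fun ω => spl x (Z ω)) = fun _ => 0 := by
    refine (Continuous.ae_eq_iff_eq μ (continuous_expMoment hW hint) continuous_const).1 ?_
    filter_upwards [coeFn_expMomentLp P μ hW fun ω => spl x (Z ω), Lp.coeFn_zero ℂ 2 μ] with t h1 h2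
    rw [← h1, ← opS_apply P μ hZ hZI hW, hx, h2]
    rfl
  have h1 := condExp_eq_zero_of_expMoment hW hint (congrFun h0)
  refine spl_injective (hcomplete _ (spl_mem_spaceG x) _ (spl_mem_spaceG 0) (h1.trans ?_))
  have : (fun ω => spl 0 (Z ω)) = 0 := funext fun ω => (spl_affine 0 (Z ω)).trans (by simp)
  rw [this, condExp_zero]

lemma opB_eq (β : ℝ × ℝ) : opB P μ Z hW β = opS P μ hZ hZI hW (β, 0) := by
  rw [opS_apply, opB]
  simp only [spl_affine]

lemma opA_eq {h : ℝ → ℝ} (hh : h ∈ spaceH) :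
    opA P μ Z hW h = opS P μ hZ hZI hW (0, (coef h hh.1).2) := by
  rw [opS_apply, opA]
  refine Lp.ext ?_
  refine (coeFn_expMomentLp _ _ _ _).trans (EventuallyEq.trans ?_ (coeFn_expMomentLp _ _ _ _).symm)
  refine EventuallyEq.of_eq (expMoment_congr ?_)
  filter_upwards [hZI] with ω hω
  have e : (0, (coef h hh.1).2) = coef h hh.1 := by
    refine Prod.ext (Prod.ext ?_ ?_) rfl
    · exact hh.2.1.symm
    · exact hh.2.2.symm
  rw [e, spl_coef hh.1 hω]

lemma opT_eq {h : ℝ → ℝ} (hh : h ∈ spaceH) :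
    opT P μ Z hW h = profileOp (opS P μ hZ hZI hW) (coef h hh.1).2 := by
  have : opB P μ Z hW = fun β => opS P μ hZ hZI hW (β, 0) :=
    funext fun β => opB_eq P μ hZ hZI hW β
  unfold opT profileOp unpenalizedRange
  simp only [this, opA_eq P μ hZ hZI hW hh]
  rfl

end Population

/-! ### Empirical moments and their deviations -/

section Empirical

variable {Ω : Type*} [MeasurableSpace Ω] {p : ℕ}

/-- The space of the observations `(Y, Z, W)`. -/
abbrev Obs (p : ℕ) : Type := ℝ × ℝ × E p

/-- The empirical moment `n⁻¹ ∑ᵢ aᵢ exp(i wᵢᵀ t)`. -/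
def empMoment (n : ℕ) (a : ℕ → ℝ) (w : ℕ → E p) (t : E p) : ℂ :=
  (n : ℂ)⁻¹ * ∑ i ∈ Finset.range n, (a i : ℂ) * expi (w i) t

/-- The difference of the empirical moment of `f` over the first `n` observations and of the
population moment. -/
def momentDev (P : Measure Ω) (V : Ω → Obs p) (f : Obs p → ℝ) (n : ℕ) (v : ℕ → Obs p) (t : E p) :
    ℂ :=
  empMoment n (fun i => f (v i)) (fun i => (v i).2.2) t -
    expMoment P (fun ω => (V ω).2.2) (fun ω => f (V ω)) t

/-- The squared deviation of a family `F` of moments, integrated over the argument `t` and over the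
parameter of the family. -/
def familyDev (P : Measure Ω) (V : Ω → Obs p) (μ : Measure (E p)) {I : Type*} [MeasurableSpace I]
    (ρ : Measure I) (F : I × Obs p → ℝ) (n : ℕ) (v : ℕ → Obs p) : ℝ≥0∞ :=
  ∫⁻ t, ∫⁻ i, ‖momentDev P V (fun v => F (i, v)) n v t‖ₑ ^ 2 ∂ρ ∂μ

/-- The mean square error of the mean of `n` independent copies is at most `n⁻¹` times the second
moment. -/
lemma integral_sq_mean_sub_le {P : Measure Ω} [IsProbabilityMeasure P] {X₀ : Ω → ℝ}
    {X : ℕ → Ω → ℝ} (hindep : Pairwise fun i j => IndepFun (X i) (X j) P)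
    (hident : ∀ i, IdentDistrib (X i) X₀ P P) (hX : MemLp X₀ 2 P) {n : ℕ} (hn : n ≠ 0) :
    Integrable (fun ω => ((n : ℝ)⁻¹ * ∑ i ∈ Finset.range n, X i ω - ∫ ω, X₀ ω ∂P) ^ 2) P ∧
    ∫ ω, ((n : ℝ)⁻¹ * ∑ i ∈ Finset.range n, X i ω - ∫ ω, X₀ ω ∂P) ^ 2 ∂P ≤
      (n : ℝ)⁻¹ * ∫ ω, X₀ ω ^ 2 ∂P := by
  have hn0 : (n : ℝ) ≠ 0 := Nat.cast_ne_zero.2 hn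
  have hXi : ∀ i, MemLp (X i) 2 P := fun i => (hident i).memLp_iff.2 hX
  have hmean : MemLp (fun ω => (n : ℝ)⁻¹ * ∑ i ∈ Finset.range n, X i ω) 2 P :=
    (memLp_finsetSum _ fun i _ => hXi i).const_mul _
  refine ⟨(hmean.sub (memLp_const _)).integrable_sq, ?_⟩
  have hE : P[fun ω => (n : ℝ)⁻¹ * ∑ i ∈ Finset.range n, X i ω] = ∫ ω, X₀ ω ∂P := by
    rw [integral_const_mul, integral_finsetSum _ fun i _ => (hXi i).integrable (by norm_num)]
    rw [Finset.sum_congr rfl fun i _ => (hident i).integral_eq]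
    simp [hn0]
  have hvar : Var[fun ω => (n : ℝ)⁻¹ * ∑ i ∈ Finset.range n, X i ω; P] =
      (n : ℝ)⁻¹ * Var[X₀; P] := by
    rw [variance_const_mul]
    have : (fun ω => ∑ i ∈ Finset.range n, X i ω) = ∑ i ∈ Finset.range n, X i := by
      ext ω
      simp
    rw [this, IndepFun.variance_sum (fun i _ => hXi i) fun i _ j _ hij => hindep hij,
      Finset.sum_congr rfl fun i _ => (hident i).variance_eq]
    simp only [Finset.sum_const, Finset.card_range, nsmul_eq_mul]
    field_simp
  rw [← hE, ← variance_eq_integral hmean.aestronglyMeasurable.aemeasurable, hvar]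
  gcongr
  exact variance_le_expectation_sq hX.aestronglyMeasurable

variable {P : Measure Ω} [IsProbabilityMeasure P] {V : Ω → Obs p} {Vs : ℕ → Ω → Obs p}

lemma lintegral_enorm_momentDev_le
    (hindep : iIndepFun Vs P) (hident : ∀ i, IdentDistrib (Vs i) V P P) (hV : Measurable V)
    {f : Obs p → ℝ} (hf : Measurable f) (hf2 : MemLp (fun ω => f (V ω)) 2 P)
    {n : ℕ} (hn : n ≠ 0) (t : E p) :
    ∫⁻ ω, ‖momentDev P V f n (fun i => Vs i ω) t‖ₑ ^ 2 ∂P ≤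
      ENNReal.ofReal ((n : ℝ)⁻¹ * ∫ ω, f (V ω) ^ 2 ∂P) := by
  have hW : Measurable fun ω => (V ω).2.2 := hV.snd.snd
  have hfi : Integrable (fun ω => f (V ω)) P := hf2.integrable (by norm_num)
  have hexp : Measurable fun v : Obs p => expi v.2.2 t :=
    (continuous_expi.comp (Continuous.prodMk_left t)).measurable.comp measurable_snd.snd
  have hintC := integrable_mul_expi hW hfi t
  have real_part : ∀ c : Obs p → ℝ, Measurable c → (∀ v, |c v| ≤ 1) →
      MemLp (fun ω => f (V ω) * c (V ω)) 2 P ∧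
      Integrable (fun ω => ((n : ℝ)⁻¹ * ∑ i ∈ Finset.range n, f (Vs i ω) * c (Vs i ω) -
        ∫ ω, f (V ω) * c (V ω) ∂P) ^ 2) P ∧
      ∫ ω, ((n : ℝ)⁻¹ * ∑ i ∈ Finset.range n, f (Vs i ω) * c (Vs i ω) -
        ∫ ω, f (V ω) * c (V ω) ∂P) ^ 2 ∂P ≤ (n : ℝ)⁻¹ * ∫ ω, (f (V ω) * c (V ω)) ^ 2 ∂P :=
    fun c hc hb => by
    have hm : MemLp (fun ω => f (V ω) * c (V ω)) 2 P :=
      hf2.of_le ((hf.mul hc).comp hV).aestronglyMeasurable (Eventually.of_forall fun ω => by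
        rw [norm_mul]
        exact mul_le_of_le_one_right (norm_nonneg _) (hb _))
    exact ⟨hm, integral_sq_mean_sub_le (X := fun i ω => f (Vs i ω) * c (Vs i ω))
      (fun i j hij => (hindep.indepFun hij).comp (hf.mul hc) (hf.mul hc))
      (fun i => (hident i).comp (hf.mul hc)) hm hn⟩
  obtain ⟨hr2, hr, hr'⟩ := real_part (fun v => (expi v.2.2 t).re)
    (Complex.measurable_re.comp hexp) fun v => (Complex.abs_re_le_norm _).trans (norm_expi _ _).le
  obtain ⟨hi2, hi, hi'⟩ := real_part (fun v => (expi v.2.2 t).im)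
    (Complex.measurable_im.comp hexp) fun v => (Complex.abs_im_le_norm _).trans (norm_expi _ _).le
  have hre : ∀ ω, (momentDev P V f n (fun i => Vs i ω) t).re =
      (n : ℝ)⁻¹ * ∑ i ∈ Finset.range n, f (Vs i ω) * (expi (Vs i ω).2.2 t).re -
        ∫ ω, f (V ω) * (expi (V ω).2.2 t).re ∂P := fun ω => by
    rw [momentDev, Complex.sub_re, empMoment, ← Complex.ofReal_natCast, ← Complex.ofReal_inv,
      Complex.re_ofReal_mul, Complex.re_sum, expMoment, ← RCLike.re_eq_complex_re,
      ← integral_re hintC]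
    simp
  have him : ∀ ω, (momentDev P V f n (fun i => Vs i ω) t).im =
      (n : ℝ)⁻¹ * ∑ i ∈ Finset.range n, f (Vs i ω) * (expi (Vs i ω).2.2 t).im -
        ∫ ω, f (V ω) * (expi (V ω).2.2 t).im ∂P := fun ω => by
    rw [momentDev, Complex.sub_im, empMoment, ← Complex.ofReal_natCast, ← Complex.ofReal_inv,
      Complex.im_ofReal_mul, Complex.im_sum, expMoment, ← RCLike.im_eq_complex_im,
      ← integral_im hintC]
    simp
  have hsq : ∀ ω, ‖momentDev P V f n (fun i => Vs i ω) t‖ₑ ^ 2 = ENNReal.ofReal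
      ((momentDev P V f n (fun i => Vs i ω) t).re ^ 2 +
        (momentDev P V f n (fun i => Vs i ω) t).im ^ 2) := fun ω => by
    rw [← ofReal_norm, ← ENNReal.ofReal_pow (norm_nonneg _), Complex.sq_norm, Complex.normSq_apply]
    ring_nf
  simp only [hsq, hre, him]
  refine (ofReal_integral_eq_lintegral_ofReal (hr.add hi)
    (Eventually.of_forall fun ω => add_nonneg (sq_nonneg _) (sq_nonneg _))).symm.trans_le ?_
  refine ENNReal.ofReal_le_ofReal ?_
  refine (integral_add hr hi).trans_le ((add_le_add hr' hi').trans_eq ?_)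
  rw [← mul_add, ← integral_add hr2.integrable_sq hi2.integrable_sq]
  congr 2
  funext ω
  have h1 : (expi (V ω).2.2 t).re ^ 2 + (expi (V ω).2.2 t).im ^ 2 = 1 := by
    have := Complex.sq_norm (expi (V ω).2.2 t)
    rw [norm_expi, Complex.normSq_apply] at this
    linarith
  linear_combination f (V ω) ^ 2 * h1

lemma measurable_expi {α : Type*} [MeasurableSpace α] {f g : α → E p} (hf : Measurable f)
    (hg : Measurable g) : Measurable fun x => expi (f x) (g x) := by
  unfold expi
  have : Measurable fun x => inner ℝ (f x) (g x) := hf.inner hg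
  fun_prop

lemma measurable_momentDev {I : Type*} [MeasurableSpace I] (hV : Measurable V)
    (hVs : ∀ i, Measurable (Vs i)) {F : I × Obs p → ℝ} (hF : Measurable F) (n : ℕ) :
    Measurable fun q : Ω × E p × I =>
      momentDev P V (fun v => F (q.2.2, v)) n (fun i => Vs i q.1) q.2.1 := by
  unfold momentDev empMoment
  refine Measurable.sub ?_ ?_
  · refine measurable_const.mul (Finset.measurable_fun_sum _ fun i _ => ?_)
    have hVi : Measurable fun q : Ω × E p × I => Vs i q.1 := (hVs i).comp measurable_fst
    have h1 : Measurable fun q : Ω × E p × I => (F (q.2.2, Vs i q.1) : ℂ) :=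
      Complex.measurable_ofReal.comp (hF.comp (measurable_snd.snd.prodMk hVi))
    have h2 : Measurable fun q : Ω × E p × I => expi (Vs i q.1).2.2 q.2.1 :=
      measurable_expi hVi.snd.snd measurable_snd.fst
    exact h1.mul h2
  · unfold expMoment
    have hVi : Measurable fun q : (Ω × E p × I) × Ω => V q.2 := hV.comp measurable_snd
    have h1 : Measurable fun q : (Ω × E p × I) × Ω => (F (q.1.2.2, V q.2) : ℂ) :=
      Complex.measurable_ofReal.comp (hF.comp (measurable_fst.snd.snd.prodMk hVi))
    have h2 : Measurable fun q : (Ω × E p × I) × Ω => expi (V q.2).2.2 q.1.2.1 :=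
      measurable_expi hVi.snd.snd measurable_fst.snd.fst
    exact (h1.mul h2).stronglyMeasurable.integral_prod_right.measurable

lemma measurable_momentDev_const {I : Type*} [MeasurableSpace I] (hV : Measurable V)
    {F : I × Obs p → ℝ} (hF : Measurable F) (n : ℕ) (v : ℕ → Obs p) :
    Measurable fun q : E p × I => momentDev P V (fun v => F (q.2, v)) n v q.1 := by
  obtain ⟨ω⟩ : Nonempty Ω := nonempty_of_isProbabilityMeasure P
  have h := measurable_momentDev (P := P) (Vs := fun i _ => v i) hV (fun i => measurable_const) hF n
  have h2 : Measurable fun q : E p × I => (ω, q) := measurable_const.prodMk measurable_id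
  have h3 := h.comp h2
  exact h3

lemma lintegral_familyDev_le {I : Type*} [MeasurableSpace I] {ρ : Measure I}
    [IsProbabilityMeasure ρ] {μ : Measure (E p)} [IsProbabilityMeasure μ]
    (hindep : iIndepFun Vs P) (hident : ∀ i, IdentDistrib (Vs i) V P P) (hV : Measurable V)
    (hVs : ∀ i, Measurable (Vs i)) {F : I × Obs p → ℝ} (hF : Measurable F) {C : ℝ}
    (hF2 : ∀ᵐ i ∂ρ, MemLp (fun ω => F (i, V ω)) 2 P ∧ ∫ ω, F (i, V ω) ^ 2 ∂P ≤ C)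
    {n : ℕ} (hn : n ≠ 0) :
    Measurable (fun ω => familyDev P V μ ρ F n fun i => Vs i ω) ∧
      ∫⁻ ω, familyDev P V μ ρ F n (fun i => Vs i ω) ∂P ≤ ENNReal.ofReal ((n : ℝ)⁻¹ * C) := by
  let G : Ω × E p × I → ℝ≥0∞ := fun q =>
    ‖momentDev P V (fun v => F (q.2.2, v)) n (fun i => Vs i q.1) q.2.1‖ₑ ^ 2
  have hm : Measurable G := (measurable_momentDev hV hVs hF n).enorm.pow_const 2
  have hm1 : Measurable fun q : (Ω × E p) × I => G (q.1.1, q.1.2, q.2) :=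
    hm.comp (measurable_fst.fst.prodMk (measurable_fst.snd.prodMk measurable_snd))
  have hm2 : Measurable fun q : Ω × E p => ∫⁻ i, G (q.1, q.2, i) ∂ρ := hm1.lintegral_prod_right'
  refine ⟨hm2.lintegral_prod_right', ?_⟩
  change ∫⁻ ω, ∫⁻ t, ∫⁻ i, G (ω, t, i) ∂ρ ∂μ ∂P ≤ _
  rw [lintegral_lintegral_swap (f := fun ω t => ∫⁻ i, G (ω, t, i) ∂ρ) hm2.aemeasurable]
  have hc : ∫⁻ _ : E p, ENNReal.ofReal ((n : ℝ)⁻¹ * C) ∂μ = ENNReal.ofReal ((n : ℝ)⁻¹ * C) := by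
    simp
  rw [← hc]
  refine lintegral_mono fun t => ?_
  have hm3 : Measurable fun q : Ω × I => G (q.1, t, q.2) :=
    hm.comp (measurable_fst.prodMk (measurable_const.prodMk measurable_snd))
  rw [lintegral_lintegral_swap (f := fun ω i => G (ω, t, i)) hm3.aemeasurable]
  have hc : ∫⁻ _ : I, ENNReal.ofReal ((n : ℝ)⁻¹ * C) ∂ρ = ENNReal.ofReal ((n : ℝ)⁻¹ * C) := by
    simp
  rw [← hc]
  refine lintegral_mono_ae ?_
  filter_upwards [hF2] with i hi
  refine (lintegral_enorm_momentDev_le hindep hident hV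
    (hF.comp (measurable_const.prodMk measurable_id)) hi.1 hn t).trans ?_
  refine ENNReal.ofReal_le_ofReal ?_
  gcongr
  exact hi.2

end Empirical

/-! ### Deviation of the empirical operator -/

section EmpiricalOperator

variable {Ω : Type*} [MeasurableSpace Ω] {p : ℕ}

lemma continuous_empMoment (n : ℕ) (a : ℕ → ℝ) (w : ℕ → E p) : Continuous (empMoment n a w) :=
  continuous_const.mul (continuous_finsetSum _ fun i _ =>
    continuous_const.mul (continuous_expi.comp (Continuous.prodMk_right (w i))))

lemma memLp_empMoment (μ : Measure (E p)) [IsProbabilityMeasure μ] (n : ℕ) (a : ℕ → ℝ)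
    (w : ℕ → E p) : MemLp (empMoment n a w) 2 μ := by
  refine MemLp.of_bound (continuous_empMoment n a w).aestronglyMeasurable
    (‖(n : ℂ)⁻¹‖ * ∑ i ∈ Finset.range n, ‖(a i : ℂ)‖) (Eventually.of_forall fun t => ?_)
  rw [empMoment, norm_mul]
  gcongr
  refine (norm_sum_le _ _).trans (Finset.sum_le_sum fun i _ => ?_)
  rw [norm_mul, norm_expi, mul_one]

lemma empMoment_add (n : ℕ) (a b : ℕ → ℝ) (w : ℕ → E p) :
    empMoment n (fun i => a i + b i) w = empMoment n a w + empMoment n b w := by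
  funext t
  simp only [empMoment, Pi.add_apply, ← mul_add, ← Finset.sum_add_distrib]
  congr 1
  refine Finset.sum_congr rfl fun i _ => ?_
  push_cast
  ring

lemma empMoment_const_mul (n : ℕ) (c : ℝ) (a : ℕ → ℝ) (w : ℕ → E p) :
    empMoment n (fun i => c * a i) w = c • empMoment n a w := by
  funext t
  simp only [empMoment, Pi.smul_apply, Complex.real_smul, Finset.mul_sum]
  refine Finset.sum_congr rfl fun i _ => ?_
  push_cast
  ring

variable (μ : Measure (E p)) [IsProbabilityMeasure μ]

/-- The empirical moment as an element of `L²_μ`. -/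
def empMomentLp (n : ℕ) (a : ℕ → ℝ) (w : ℕ → E p) : Lp ℂ 2 μ :=
  (memLp_empMoment μ n a w).toLp

lemma empMomentLp_add (n : ℕ) (a b : ℕ → ℝ) (w : ℕ → E p) :
    empMomentLp μ n (fun i => a i + b i) w = empMomentLp μ n a w + empMomentLp μ n b w :=
  (MemLp.toLp_congr _ ((memLp_empMoment μ n a w).add (memLp_empMoment μ n b w))
    (EventuallyEq.of_eq (empMoment_add n a b w))).trans (MemLp.toLp_add _ _)

lemma empMomentLp_const_mul (n : ℕ) (c : ℝ) (a : ℕ → ℝ) (w : ℕ → E p) :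
    empMomentLp μ n (fun i => c * a i) w = c • empMomentLp μ n a w :=
  (MemLp.toLp_congr _ ((memLp_empMoment μ n a w).const_smul c)
    (EventuallyEq.of_eq (empMoment_const_mul n c a w))).trans (MemLp.toLp_const_smul _ _)

/-- The empirical counterpart of `opS`, for the observations `v`. -/
def empOp (n : ℕ) (v : ℕ → Obs p) : Coef →ₗ[ℝ] Lp ℂ 2 μ where
  toFun x := empMomentLp μ n (fun i => spl x (v i).2.1) fun i => (v i).2.2
  map_add' x y := by
    simp only [spl_add]
    exact empMomentLp_add μ n _ _ _
  map_smul' c x := by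
    simp only [spl_smul]
    exact empMomentLp_const_mul μ n c _ _

lemma empOp_apply (n : ℕ) (v : ℕ → Obs p) (x : Coef) : empOp μ n v x =
    empMomentLp μ n (fun i => spl x (v i).2.1) fun i => (v i).2.2 := rfl

lemma criterion_eq (n : ℕ) (v : ℕ → Obs p) {g : ℝ → ℝ} {x : Coef}
    (h : ∀ i, g (v i).2.1 = spl x (v i).2.1) :
    criterion μ n (fun i => (v i).1) (fun i => (v i).2.1) (fun i => (v i).2.2) g =
      ‖empMomentLp μ n (fun i => (v i).1) (fun i => (v i).2.2) - empOp μ n v x‖ ^ 2 := by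
  have e : empMomentLp μ n (fun i => (v i).1) (fun i => (v i).2.2) - empOp μ n v x =
      empMomentLp μ n (fun i => (v i).1 - g (v i).2.1) (fun i => (v i).2.2) := by
    rw [sub_eq_iff_eq_add, empOp_apply, ← empMomentLp_add]
    simp only [h, sub_add_cancel]
  rw [e, norm_sq_Lp, criterion]
  refine integral_congr_ae ?_
  filter_upwards [(memLp_empMoment μ n (fun i => (v i).1 - g (v i).2.1)
    fun i => (v i).2.2).coeFn_toLp] with t ht
  rw [empMomentLp, ht, empMoment]

/-- A smoothing spline estimate satisfies the normal equations, in coordinates. -/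
lemma IsSplineEstimate.normal_equations {lam : ℝ} {n : ℕ} {v : ℕ → Obs p} {g : ℝ → ℝ}
    (h : IsSplineEstimate μ lam n (fun i => (v i).1) (fun i => (v i).2.1) (fun i => (v i).2.2) g)
    (hv : ∀ i, (v i).2.1 ∈ Icc (0 : ℝ) 1) (x₀ x : Coef) :
    inner ℝ (empMomentLp μ n (fun i => (v i).1 - spl x₀ (v i).2.1) (fun i => (v i).2.2) -
      empOp μ n v (coef g h.1 - x₀)) (empOp μ n v x) = lam * inner ℝ (coef g h.1).2 x.2 := by
  have hmin := normal_equations_of_isMin (empOp μ n v) (LinearMap.snd ℝ (ℝ × ℝ) L2I) (lam := lam)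
    (y := empMomentLp μ n (fun i => (v i).1) (fun i => (v i).2.2)) (xh := coef g h.1) ?_ x
  · rw [LinearMap.snd_apply, LinearMap.snd_apply] at hmin
    rw [← hmin]
    congr 1
    rw [map_sub, sub_sub_eq_add_sub, empOp_apply μ n v x₀, ← empMomentLp_add]
    simp only [sub_add_cancel]
  · intro x
    have h1 := h.2 (spl_mem_spaceG x)
    simp only [penalizedCriterion, mem_ofPred_eq] at h1
    rw [criterion_eq μ n v (fun i => (spl_coef h.1 (hv i)).symm), criterion_eq μ n v (fun i => rfl),
      integral_d2_sq h.1, integral_d2_sq (spl_mem_spaceG x), coef_spl] at h1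
    exact h1

/-! ### The deviation in terms of moments -/

variable {P : Measure Ω} {V : Ω → Obs p}

lemma momentDev_add (hV : Measurable V) {f g : Obs p → ℝ} (hf : Integrable (fun ω => f (V ω)) P)
    (hg : Integrable (fun ω => g (V ω)) P) (n : ℕ) (v : ℕ → Obs p) (t : E p) :
    momentDev P V (fun v => f v + g v) n v t = momentDev P V f n v t + momentDev P V g n v t := by
  unfold momentDev
  rw [expMoment_add hV.snd.snd hf hg, empMoment_add, Pi.add_apply]
  ring

lemma momentDev_const_mul (c : ℝ) (f : Obs p → ℝ) (n : ℕ) (v : ℕ → Obs p) (t : E p) :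
    momentDev P V (fun v => c * f v) n v t = c * momentDev P V f n v t := by
  unfold momentDev
  rw [expMoment_const_mul, empMoment_const_mul, Pi.smul_apply, Complex.real_smul]
  ring

variable [IsProbabilityMeasure P]

/-- The deviation operator commutes with the integral in the definition of `spl`. -/
lemma momentDev_integral (hV : Measurable V) (hVI : ∀ᵐ ω ∂P, (V ω).2.1 ∈ Icc (0 : ℝ) 1) (u : L2I)
    (n : ℕ) (v : ℕ → Obs p) (t : E p) :
    momentDev P V (fun v => ∫ s in Icc (0 : ℝ) 1, max (v.2.1 - s) 0 * u s) n v t =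
      ∫ s in Icc (0 : ℝ) 1, (u s : ℂ) * momentDev P V (fun v => max (v.2.1 - s) 0) n v t := by
  set ν := volume.restrict (Icc (0 : ℝ) 1) with hν
  have hterm : ∀ i, Integrable (fun s => (max ((v i).2.1 - s) 0 * u s : ℝ) * expi (v i).2.2 t) ν :=
    fun i => (integrable_max_mul u (v i).2.1).ofReal.mul_const _
  have hemp : (∫ s, (u s : ℂ) * empMoment n (fun i => max ((v i).2.1 - s) 0)
      (fun i => (v i).2.2) t ∂ν) = empMoment n (fun i => ∫ s, max ((v i).2.1 - s) 0 * u s ∂ν)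
        (fun i => (v i).2.2) t ∧ Integrable (fun s => (u s : ℂ) *
          empMoment n (fun i => max ((v i).2.1 - s) 0) (fun i => (v i).2.2) t) ν := by
    have e : (fun s => (u s : ℂ) * empMoment n (fun i => max ((v i).2.1 - s) 0)
        (fun i => (v i).2.2) t) = fun s => (n : ℂ)⁻¹ * ∑ i ∈ Finset.range n,
          (max ((v i).2.1 - s) 0 * u s : ℝ) * expi (v i).2.2 t := by
      funext s
      rw [empMoment, mul_left_comm, Finset.mul_sum]
      congr 1
      refine Finset.sum_congr rfl fun i _ => ?_
      push_cast
      ring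
    rw [e]
    refine ⟨?_, (integrable_finsetSum _ fun i _ => hterm i).const_mul _⟩
    rw [integral_const_mul, integral_finsetSum _ fun i _ => hterm i, empMoment]
    congr 1
    refine Finset.sum_congr rfl fun i _ => ?_
    rw [integral_mul_const, integral_complex_ofReal]
  have hprod : Integrable (fun q : Ω × ℝ =>
      (max ((V q.1).2.1 - q.2) 0 * u q.2 : ℝ) * expi (V q.1).2.2 t) (P.prod ν) := by
    have h1 : Integrable (fun q : Ω × ℝ => u q.2) (P.prod ν) := (integrable_L2I u).comp_snd P
    have h2 : Integrable (fun q : Ω × ℝ => max ((V q.1).2.1 - q.2) 0 * u q.2) (P.prod ν) := by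
      refine h1.bdd_mul (c := 1) ?_ ?_
      · have h3 : Measurable fun q : Ω × ℝ => (V q.1).2.1 := hV.snd.fst.comp measurable_fst
        exact ((h3.sub measurable_snd).max measurable_const).aestronglyMeasurable
      · have h3 := (Measure.quasiMeasurePreserving_fst (μ := P) (ν := ν)).ae hVI
        have h4 := (Measure.quasiMeasurePreserving_snd (μ := P) (ν := ν)).ae
          (ae_restrict_mem measurableSet_Icc)
        filter_upwards [h3, h4] with q hq hs
        rw [Real.norm_eq_abs, abs_of_nonneg (le_max_right _ _)]
        exact max_le (by linarith [hq.2, hs.1]) zero_le_one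
    exact h2.ofReal.mul_bdd (c := 1)
      (measurable_expi (hV.snd.snd.comp measurable_fst) measurable_const).aestronglyMeasurable
      (Eventually.of_forall fun _ => (norm_expi _ _).le)
  have hpop : ∀ s, (u s : ℂ) * expMoment P (fun ω => (V ω).2.2)
      (fun ω => max ((V ω).2.1 - s) 0) t =
        ∫ ω, (max ((V ω).2.1 - s) 0 * u s : ℝ) * expi (V ω).2.2 t ∂P := fun s => by
    rw [expMoment, ← integral_const_mul]
    congr 1
    funext ω
    push_cast
    ring
  have hpop2 : (∫ s, (u s : ℂ) * expMoment P (fun ω => (V ω).2.2)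
      (fun ω => max ((V ω).2.1 - s) 0) t ∂ν) = expMoment P (fun ω => (V ω).2.2)
        (fun ω => ∫ s, max ((V ω).2.1 - s) 0 * u s ∂ν) t := by
    simp only [hpop]
    rw [← integral_integral_swap hprod, expMoment]
    congr 1
    funext ω
    rw [integral_mul_const, integral_complex_ofReal]
  have hint2 : Integrable (fun s => (u s : ℂ) * expMoment P (fun ω => (V ω).2.2)
      (fun ω => max ((V ω).2.1 - s) 0) t) ν := by
    simp only [hpop]
    exact hprod.integral_prod_right
  simp only [momentDev, mul_sub]
  rw [integral_sub hemp.2 hint2, hemp.1, hpop2]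

/-- The deviation that controls the estimation error: the moments of `1`, of `Z` and of the kernels
`(Z - s)₊` bound the deviation of the operator in Hilbert-Schmidt norm, those of `Y - g₀(Z)` are the
noise. -/
def totalDev (P : Measure Ω) (V : Ω → Obs p) (μ : Measure (E p)) (x₀ : Coef) (n : ℕ)
    (v : ℕ → Obs p) : ℝ≥0∞ :=
  3 * (familyDev P V μ (Measure.dirac ()) (fun _ => 1) n v +
    familyDev P V μ (Measure.dirac ()) (fun q => q.2.2.1) n v +
    familyDev P V μ (volume.restrict (Icc (0 : ℝ) 1)) (fun q => max (q.2.2.1 - q.1) 0) n v) +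
  familyDev P V μ (Measure.dirac ()) (fun q => q.2.1 - spl x₀ q.2.2.1) n v

lemma ennreal_add_sq_le (a b c : ℝ≥0∞) : (a + b + c) ^ 2 ≤ 3 * (a ^ 2 + b ^ 2 + c ^ 2) := by
  rcases eq_or_ne a ∞ with rfl | ha
  · simp
  rcases eq_or_ne b ∞ with rfl | hb
  · simp
  rcases eq_or_ne c ∞ with rfl | hc
  · simp
  lift a to NNReal using ha
  lift b to NNReal using hb
  lift c to NNReal using hc
  norm_cast
  rw [← NNReal.coe_le_coe]
  push_cast
  nlinarith [sq_nonneg ((a : ℝ) - b), sq_nonneg ((b : ℝ) - c), sq_nonneg ((a : ℝ) - c)]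

lemma lintegral_mul_sq_le {α : Type*} [MeasurableSpace α] {ν : Measure α} {f g : α → ℝ≥0∞}
    (hf : AEMeasurable f ν) (hg : AEMeasurable g ν) :
    (∫⁻ a, f a * g a ∂ν) ^ 2 ≤ (∫⁻ a, f a ^ 2 ∂ν) * ∫⁻ a, g a ^ 2 ∂ν := by
  have h := ENNReal.lintegral_mul_le_Lp_mul_Lq ν Real.HolderConjugate.two_two hf hg
  simp only [Pi.mul_apply, ENNReal.rpow_two] at h
  refine (pow_le_pow_left₀ zero_le h 2).trans_eq ?_
  rw [mul_pow, ← ENNReal.rpow_natCast, ← ENNReal.rpow_natCast, ← ENNReal.rpow_mul,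
    ← ENNReal.rpow_mul]
  norm_num

/-- Pointwise in `t`, the deviation of the moment of `spl x` is linear in `x`; the Cauchy-Schwarz
inequality separates `x` from the deviations of the kernels. -/
lemma enorm_sq_momentDev_spl_le (hV : Measurable V)
    (hVI : ∀ᵐ ω ∂P, (V ω).2.1 ∈ Icc (0 : ℝ) 1) (x : Coef) (n : ℕ) (v : ℕ → Obs p) (t : E p) :
    ‖momentDev P V (fun v => spl x v.2.1) n v t‖ₑ ^ 2 ≤
      ‖x‖ₑ ^ 2 * (3 * (‖momentDev P V (fun _ => 1) n v t‖ₑ ^ 2 +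
        ‖momentDev P V (fun v => v.2.1) n v t‖ₑ ^ 2 + ∫⁻ s in Icc (0 : ℝ) 1,
          ‖momentDev P V (fun v => max (v.2.1 - s) 0) n v t‖ₑ ^ 2)) := by
  have hZ : Measurable fun ω => (V ω).2.1 := hV.snd.fst
  have hint : ∀ x : Coef, Integrable (fun ω => spl x (V ω).2.1) P := fun x =>
    memLp_one_iff_integrable.1 (memLp_spl hZ hVI x 1)
  have hdecomp : momentDev P V (fun v => spl x v.2.1) n v t =
      x.1.1 * momentDev P V (fun _ => 1) n v t + x.1.2 * momentDev P V (fun v => v.2.1) n v t +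
      ∫ s in Icc (0 : ℝ) 1, (x.2 s : ℂ) * momentDev P V (fun v => max (v.2.1 - s) 0) n v t := by
    have h1 : Integrable (fun _ : Ω => x.1.1 * (1 : ℝ)) P := integrable_const _
    have h2 : Integrable (fun ω => x.1.2 * (V ω).2.1) P := by
      simpa [spl_affine] using hint ((0, x.1.2), 0)
    have h3 : Integrable (fun ω => ∫ s in Icc (0 : ℝ) 1, max ((V ω).2.1 - s) 0 * x.2 s) P := by
      simpa [spl] using hint (0, x.2)
    rw [← momentDev_integral hV hVI, ← momentDev_const_mul, ← momentDev_const_mul,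
      ← momentDev_add hV (f := fun _ => x.1.1 * 1) h1 h2,
      ← momentDev_add hV (f := fun v => x.1.1 * 1 + x.1.2 * v.2.1) (h1.add h2) h3]
    simp only [spl, mul_one]
  have hm : Measurable fun s => momentDev P V (fun v => max (v.2.1 - s) 0) n v t := by
    have h := measurable_momentDev_const (P := P) (F := fun q : ℝ × Obs p => max (q.2.2.1 - q.1) 0)
      hV ((measurable_snd.snd.fst.sub measurable_fst).max measurable_const) n v
    have h2 : Measurable fun s : ℝ => (t, s) := measurable_const.prodMk measurable_id
    have h3 := h.comp h2
    exact h3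
  have hx1 : ‖(x.1.1 : ℂ)‖ₑ ≤ ‖x‖ₑ := by
    rw [enorm_le_iff_norm_le, Complex.norm_real]
    exact (norm_fst_le x.1).trans (norm_fst_le x)
  have hx2 : ‖(x.1.2 : ℂ)‖ₑ ≤ ‖x‖ₑ := by
    rw [enorm_le_iff_norm_le, Complex.norm_real]
    exact (norm_snd_le x.1).trans (norm_fst_le x)
  have hx3 : ∫⁻ s in Icc (0 : ℝ) 1, ‖x.2 s‖ₑ ^ 2 ≤ ‖x‖ₑ ^ 2 := by
    rw [← enorm_sq_Lp]
    gcongr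
    rw [enorm_le_iff_norm_le]
    exact norm_snd_le x
  have h3 : ‖∫ s in Icc (0 : ℝ) 1, (x.2 s : ℂ) *
      momentDev P V (fun v => max (v.2.1 - s) 0) n v t‖ₑ ^ 2 ≤ ‖x‖ₑ ^ 2 * ∫⁻ s in Icc (0 : ℝ) 1,
        ‖momentDev P V (fun v => max (v.2.1 - s) 0) n v t‖ₑ ^ 2 := by
    refine (pow_le_pow_left₀ zero_le (enorm_integral_le_lintegral_enorm _) 2).trans ?_
    have e : ∀ s, ‖(x.2 s : ℂ) * momentDev P V (fun v => max (v.2.1 - s) 0) n v t‖ₑ =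
        ‖x.2 s‖ₑ * ‖momentDev P V (fun v => max (v.2.1 - s) 0) n v t‖ₑ := fun s => by
      rw [enorm_mul]
      congr 1
      rw [← ofReal_norm, Complex.norm_real, ofReal_norm]
    simp only [e]
    refine (lintegral_mul_sq_le (Lp.memLp x.2).aestronglyMeasurable.enorm
      hm.enorm.aemeasurable).trans ?_
    gcongr
  rw [hdecomp]
  refine (pow_le_pow_left₀ zero_le ((enorm_add_le _ _).trans
    (add_le_add_left (enorm_add_le _ _) _)) 2).trans ((ennreal_add_sq_le _ _ _).trans ?_)
  rw [mul_left_comm, mul_add (‖x‖ₑ ^ 2), mul_add (‖x‖ₑ ^ 2), enorm_mul, enorm_mul, mul_pow, mul_pow]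
  gcongr

end EmpiricalOperator

/-! ### The order of the deviation in probability -/

section DeviationBounds

variable {Ω : Type*} [MeasurableSpace Ω] {p : ℕ} (μ : Measure (E p)) [IsProbabilityMeasure μ]
  {P : Measure Ω} {V : Ω → Obs p}

lemma norm_le_of_enorm_sq_le {F G : Type*} [NormedAddCommGroup F] [NormedAddCommGroup G] {a : F}
    {x : G} {D : ℝ} (hD : 0 ≤ D) (h : ‖a‖ₑ ^ 2 ≤ ‖x‖ₑ ^ 2 * ENNReal.ofReal (D ^ 2)) :
    ‖a‖ ≤ D * ‖x‖ := by
  rw [← ofReal_norm, ← ofReal_norm, ← ENNReal.ofReal_pow (norm_nonneg _),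
    ← ENNReal.ofReal_pow (norm_nonneg _), ← ENNReal.ofReal_mul (by positivity),
    ENNReal.ofReal_le_ofReal_iff (by positivity)] at h
  refine (abs_le_of_sq_le_sq' ?_ (by positivity)).2
  rwa [mul_pow, mul_comm]

lemma enorm_sq_noise_le {x₀ : Coef}
    (h0 : ∀ t, expMoment P (fun ω => (V ω).2.2) (fun ω => (V ω).1 - spl x₀ (V ω).2.1) t = 0)
    (n : ℕ) (v : ℕ → Obs p) :
    ‖empMomentLp μ n (fun i => (v i).1 - spl x₀ (v i).2.1) (fun i => (v i).2.2)‖ₑ ^ 2 ≤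
      totalDev P V μ x₀ n v := by
  rw [enorm_sq_Lp, totalDev]
  refine le_trans (le_of_eq ?_) le_add_self
  rw [familyDev]
  simp only [lintegral_dirac]
  refine lintegral_congr_ae ?_
  filter_upwards [(memLp_empMoment μ n (fun i => (v i).1 - spl x₀ (v i).2.1)
    fun i => (v i).2.2).coeFn_toLp] with t ht
  rw [empMomentLp, ht, momentDev, h0, sub_zero]

variable [IsProbabilityMeasure P]

lemma enorm_sq_empOp_sub_le (hV : Measurable V) (hVI : ∀ᵐ ω ∂P, (V ω).2.1 ∈ Icc (0 : ℝ) 1)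
    (x₀ x : Coef) (n : ℕ) (v : ℕ → Obs p) :
    ‖empOp μ n v x - opS P μ hV.snd.fst hVI hV.snd.snd x‖ₑ ^ 2 ≤
      ‖x‖ₑ ^ 2 * totalDev P V μ x₀ n v := by
  set S := opS P μ hV.snd.fst hVI hV.snd.snd with hS
  have hcoe : (empOp μ n v x - S x : Lp ℂ 2 μ) =ᵐ[μ]
      momentDev P V (fun v => spl x v.2.1) n v := by
    filter_upwards [Lp.coeFn_sub (empOp μ n v x) (S x),
      coeFn_expMomentLp P μ hV.snd.snd fun ω => spl x (V ω).2.1,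
      (memLp_empMoment μ n (fun i => spl x (v i).2.1) fun i => (v i).2.2).coeFn_toLp]
      with t h1 h2 h3
    rw [h1, Pi.sub_apply, hS, opS_apply, h2, empOp_apply, empMomentLp, h3]
    rfl
  have hm0 : Measurable fun t => ‖momentDev P V (fun _ => 1) n v t‖ₑ ^ 2 :=
    (((measurable_momentDev_const (P := P) (F := fun _ : Unit × Obs p => 1) hV measurable_const n
      v).comp (measurable_id.prodMk (measurable_const (a := ())))).enorm.pow_const 2)
  have hm1 : Measurable fun t => ‖momentDev P V (fun v => v.2.1) n v t‖ₑ ^ 2 :=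
    (((measurable_momentDev_const (P := P) (F := fun q : Unit × Obs p => q.2.2.1) hV
      measurable_snd.snd.fst n v).comp
        (measurable_id.prodMk (measurable_const (a := ())))).enorm.pow_const 2)
  have hm01 : Measurable fun t => ‖momentDev P V (fun _ => 1) n v t‖ₑ ^ 2 +
      ‖momentDev P V (fun v => v.2.1) n v t‖ₑ ^ 2 := hm0.add hm1
  calc ‖empOp μ n v x - S x‖ₑ ^ 2
      = ∫⁻ t, ‖momentDev P V (fun v => spl x v.2.1) n v t‖ₑ ^ 2 ∂μ := by
        rw [enorm_sq_Lp]
        refine lintegral_congr_ae ?_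
        filter_upwards [hcoe] with t ht
        rw [ht]
    _ ≤ ∫⁻ t, ‖x‖ₑ ^ 2 * (3 * (‖momentDev P V (fun _ => 1) n v t‖ₑ ^ 2 +
        ‖momentDev P V (fun v => v.2.1) n v t‖ₑ ^ 2 + ∫⁻ s in Icc (0 : ℝ) 1,
          ‖momentDev P V (fun v => max (v.2.1 - s) 0) n v t‖ₑ ^ 2)) ∂μ :=
        lintegral_mono fun t => enorm_sq_momentDev_spl_le hV hVI x n v t
    _ = ‖x‖ₑ ^ 2 * (3 * (familyDev P V μ (Measure.dirac ()) (fun _ => 1) n v +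
          familyDev P V μ (Measure.dirac ()) (fun q => q.2.2.1) n v +
          familyDev P V μ (volume.restrict (Icc (0 : ℝ) 1))
            (fun q => max (q.2.2.1 - q.1) 0) n v)) := by
        rw [lintegral_const_mul' _ _ (by finiteness), lintegral_const_mul' _ _ (by finiteness),
          lintegral_add_left hm01, lintegral_add_left hm0]
        simp only [familyDev, lintegral_dirac]
    _ ≤ _ := by
        rw [totalDev]
        gcongr
        exact le_self_add

/-- The squared deviation is of order `1 / n` in probability. -/
lemma exists_measure_totalDev_le {Vs : ℕ → Ω → Obs p} (hindep : iIndepFun Vs P)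
    (hident : ∀ i, IdentDistrib (Vs i) V P P) (hV : Measurable V) (hVs : ∀ i, Measurable (Vs i))
    (hVI : ∀ᵐ ω ∂P, (V ω).2.1 ∈ Icc (0 : ℝ) 1) (hY : MemLp (fun ω => (V ω).1) 2 P) (x₀ : Coef)
    {ε : ℝ} (hε : 0 < ε) :
    ∃ M, 0 < M ∧ ∀ n : ℕ, n ≠ 0 →
      P {ω | ENNReal.ofReal (M / n) ≤ totalDev P V μ x₀ n fun i => Vs i ω} ≤ ENNReal.ofReal ε := by
  have : IsProbabilityMeasure (volume.restrict (Icc (0 : ℝ) 1)) := ⟨by simp⟩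
  have hbdd : ∀ f : Obs p → ℝ, Measurable f → (∀ᵐ ω ∂P, |f (V ω)| ≤ 1) →
      MemLp (fun ω => f (V ω)) 2 P ∧ ∫ ω, f (V ω) ^ 2 ∂P ≤ 1 := by
    intro f hf hb
    have hm : MemLp (fun ω => f (V ω)) 2 P :=
      MemLp.of_bound (hf.comp hV).aestronglyMeasurable 1 hb
    refine ⟨hm, ?_⟩
    have : ∫ _ : Ω, (1 : ℝ) ∂P = 1 := by simp
    rw [← this]
    refine integral_mono_ae hm.integrable_sq (integrable_const _) ?_
    filter_upwards [hb] with ω hω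
    exact (sq_le_one_iff_abs_le_one _).2 hω
  set u : Obs p → ℝ := fun v => v.1 - spl x₀ v.2.1 with hu
  have hum : Measurable u := measurable_fst.sub ((continuous_spl x₀).measurable.comp
    measurable_snd.fst)
  have hu2 : MemLp (fun ω => u (V ω)) 2 P := hY.sub (memLp_spl hV.snd.fst hVI x₀ 2)
  set B := ∫ ω, u (V ω) ^ 2 ∂P with hB
  have hB0 : 0 ≤ B := integral_nonneg fun ω => sq_nonneg _
  refine ⟨(9 + B) / ε, by positivity, fun n hn => ?_⟩
  have hn0 : (0 : ℝ) < n := Nat.cast_pos.2 (Nat.pos_of_ne_zero hn)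
  obtain ⟨ma, ha⟩ := lintegral_familyDev_le (μ := μ) (ρ := Measure.dirac ()) (C := 1) hindep hident
    hV hVs (F := fun _ => 1) measurable_const
    (Eventually.of_forall fun _ => hbdd (fun _ => 1) measurable_const (by simp)) hn
  obtain ⟨mb, hb⟩ := lintegral_familyDev_le (μ := μ) (ρ := Measure.dirac ()) (C := 1) hindep hident
    hV hVs (F := fun q => q.2.2.1) measurable_snd.snd.fst
    (Eventually.of_forall fun _ => hbdd (fun v => v.2.1) measurable_snd.fst (by
      filter_upwards [hVI] with ω hω
      rw [abs_of_nonneg hω.1]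
      exact hω.2)) hn
  obtain ⟨mc, hc⟩ := lintegral_familyDev_le (μ := μ) (ρ := volume.restrict (Icc (0 : ℝ) 1)) (C := 1)
    hindep hident hV hVs (F := fun q => max (q.2.2.1 - q.1) 0)
    ((measurable_snd.snd.fst.sub measurable_fst).max measurable_const)
    ((ae_restrict_mem measurableSet_Icc).mono fun s hs => hbdd (fun v => max (v.2.1 - s) 0)
      ((measurable_snd.fst.sub measurable_const).max measurable_const) (by
        filter_upwards [hVI] with ω hω
        rw [abs_of_nonneg (le_max_right _ _)]
        exact max_le (by linarith [hω.2, hs.1]) zero_le_one)) hn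
  obtain ⟨md, hd⟩ := lintegral_familyDev_le (μ := μ) (ρ := Measure.dirac ()) (C := B) hindep hident
    hV hVs (F := fun q => u q.2) (hum.comp measurable_snd)
    (Eventually.of_forall fun _ => ⟨hu2, le_rfl⟩) hn
  have hmeas : Measurable fun ω => totalDev P V μ x₀ n fun i => Vs i ω :=
    (((ma.add mb).add mc).const_mul 3).add md
  have hE : ∫⁻ ω, totalDev P V μ x₀ n (fun i => Vs i ω) ∂P ≤
      ENNReal.ofReal ((n : ℝ)⁻¹ * (9 + B)) := by
    unfold totalDev
    rw [lintegral_add_right _ md, lintegral_const_mul' _ _ (by finiteness),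
      lintegral_add_right _ mc, lintegral_add_right _ mb]
    refine (add_le_add (mul_le_mul_right (add_le_add (add_le_add ha hb) hc) 3) hd).trans_eq ?_
    have h3 : (3 : ℝ≥0∞) = ENNReal.ofReal 3 := by simp
    rw [h3, ← ENNReal.ofReal_add (by positivity) (by positivity),
      ← ENNReal.ofReal_add (by positivity) (by positivity), ← ENNReal.ofReal_mul (by positivity),
      ← ENNReal.ofReal_add (by positivity) (by positivity)]
    congr 1
    ring
  have hpos : 0 < (9 + B) / ε / n := by positivity
  refine (meas_ge_le_lintegral_div hmeas.aemeasurable (ENNReal.ofReal_pos.2 hpos).ne'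
    ENNReal.ofReal_ne_top).trans ?_
  refine (ENNReal.div_le_div_right hE _).trans_eq ?_
  rw [← ENNReal.ofReal_div_of_pos hpos]
  congr 1
  field_simp

end DeviationBounds

/-! ### The stochastic error of the spline estimator -/

section ErrorBound

variable {Ω : Type*} [MeasurableSpace Ω] {p : ℕ} {μ : Measure (E p)} [IsProbabilityMeasure μ]
  {P : Measure Ω} [IsProbabilityMeasure P] {V : Ω → Obs p}

/-- On the event that the deviation is at most `M / n`, the error of the estimator is bounded by a
stochastic term of order `1 / √(n lam)` and the bias of population Tikhonov regularization. -/
lemma exists_norm_coef_sub_le (hV : Measurable V) (hVI : ∀ᵐ ω ∂P, (V ω).2.1 ∈ Icc (0 : ℝ) 1)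
    (hinj : Function.Injective (opS P μ hV.snd.fst hVI hV.snd.snd)) {x₀ : Coef}
    (h0 : ∀ t, expMoment P (fun ω => (V ω).2.2) (fun ω => (V ω).1 - spl x₀ (V ω).2.1) t = 0) :
    ∃ C η : ℝ, 0 < C ∧ 0 < η ∧ ∀ (lam : ℝ) (n : ℕ) (M : ℝ) (v : ℕ → Obs p) (g : ℝ → ℝ) (k : L2I),
      0 < lam → lam ≤ 1 → √(M / n) ≤ η →
      IsTikhonovBias (profileOp (opS P μ hV.snd.fst hVI hV.snd.snd)) lam x₀.2 k →
      totalDev P V μ x₀ n v ≤ ENNReal.ofReal (M / n) → (∀ i, (v i).2.1 ∈ Icc (0 : ℝ) 1) →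
      ∀ h : IsSplineEstimate μ lam n (fun i => (v i).1) (fun i => (v i).2.1) (fun i => (v i).2.2) g,
        ‖coef g h.1 - x₀‖ ≤ C * (√(M / n) / √lam + ‖k‖) := by
  set S := opS P μ hV.snd.fst hVI hV.snd.snd with hS
  obtain ⟨c, hc, hcoer⟩ := exists_norm_le_of_injective hinj
  obtain ⟨C₁, hC₁, hbias⟩ := exists_full_bias hinj
  set m := C₁ * ‖x₀.2‖ with hm
  set C₂ := 4 * c * (1 + m + 2 * c * ‖x₀.2‖) with hC₂
  have hC₂0 : 0 < C₂ := by positivity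
  refine ⟨C₁ + C₂, 1 / (2 * c), by positivity, by positivity, ?_⟩
  intro lam n M v g k hlam hlam1 hη hk hdev hvI h
  set D := √(M / n) with hD
  have hdev' : totalDev P V μ x₀ n v ≤ ENNReal.ofReal (D ^ 2) := by
    rcases le_total 0 (M / n) with hM | hM
    · rwa [hD, Real.sq_sqrt hM]
    · rw [ENNReal.ofReal_of_nonpos hM] at hdev
      exact hdev.trans zero_le
  have hD0 : 0 ≤ D := Real.sqrt_nonneg _
  obtain ⟨hk1, hk2⟩ := hk.norm_le hlam
  obtain ⟨d, hd1, hd2, hd3, hd4⟩ := hbias lam x₀.2 k hk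
  have hU : ‖empMomentLp μ n (fun i => (v i).1 - spl x₀ (v i).2.1) (fun i => (v i).2.2)‖ ≤ D := by
    have := norm_le_of_enorm_sq_le (x := (1 : ℝ)) hD0
      ((enorm_sq_noise_le μ h0 n v).trans (hdev'.trans_eq (by simp)))
    simpa using this
  have key := norm_sub_le_of_normal_equations (S : Coef →ₗ[ℝ] Lp ℂ 2 μ) (empOp μ n v)
    (LinearMap.snd ℝ (ℝ × ℝ) L2I) (c := c) (D := D) (lam := lam) (m := m) (r := ‖x₀.2‖) hc hD0 hlam
    hlam1 (by rw [le_div_iff₀ (by positivity)] at hη; linarith) (by positivity) (norm_nonneg _)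
    (fun x => norm_le_of_enorm_sq_le hD0
      ((enorm_sq_empOp_sub_le μ hV hVI x₀ x n v).trans (by gcongr)))
    hcoer (d := d) (x₀ := x₀) (xh := coef g h.1) hU (by
      change ‖S d‖ ≤ _
      rw [hd2]; exact hk2)
    (hd3.trans (by rw [hm]; gcongr)) (fun x => hd4 x) (fun x => h.normal_equations μ hvI x₀ x)
  refine key.trans ?_
  have h1 : 0 ≤ D / √lam := by positivity
  have h2 := norm_nonneg k
  nlinarith [mul_nonneg hC₁ h1, mul_nonneg hC₂0.le h2]

end ErrorBound

/-! ### From tail bounds to stochastic orders -/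

section Rates

variable {Ω : Type*} [MeasurableSpace Ω] {P : Measure Ω}

lemma tendstoInMeasure_of_tail {X : ℕ → Ω → ℝ} {a b : ℕ → ℝ} {C : ℝ}
    (ha : Tendsto a atTop (𝓝 0)) (hb : Tendsto b atTop (𝓝 0))
    (htail : ∀ ε, 0 < ε → ∃ M, 0 < M ∧ ∀ᶠ n in atTop,
      P {ω | C * (M * a n + b n) < |X n ω|} ≤ ENNReal.ofReal ε) :
    TendstoInMeasure P X atTop fun _ => (0 : ℝ) := by
  rw [tendstoInMeasure_iff_norm]
  intro r hr
  rw [ENNReal.tendsto_nhds_zero]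
  intro ε hε
  rcases eq_or_ne ε ∞ with rfl | hε'
  · exact Eventually.of_forall fun _ => le_top
  obtain ⟨M, -, hM⟩ := htail ε.toReal (ENNReal.toReal_pos hε.ne' hε')
  rw [ENNReal.ofReal_toReal hε'] at hM
  have hlim : Tendsto (fun n => C * (M * a n + b n)) atTop (𝓝 0) := by
    simpa using ((ha.const_mul M).add hb).const_mul C
  filter_upwards [hM, hlim.eventually (gt_mem_nhds hr)] with n hn hn'
  refine (measure_mono fun ω hω => ?_).trans hn
  simp only [mem_ofPred_eq, sub_zero, Real.norm_eq_abs] at hω ⊢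
  exact hn'.trans_le hω

lemma isBigOP_of_tail {X : ℕ → Ω → ℝ} {a b c : ℕ → ℝ} {C K : ℝ} (hC : 0 ≤ C) (hK : 0 ≤ K)
    (ha : ∀ n, 0 ≤ a n) (hc : ∀ n, 0 ≤ c n) (hb : ∀ n, b n ≤ K * c n)
    (htail : ∀ ε, 0 < ε → ∃ M, 0 < M ∧ ∀ᶠ n in atTop,
      P {ω | C * (M * a n + b n) < |X n ω|} ≤ ENNReal.ofReal ε) :
    IsBigOP P X fun n => a n + c n := by
  intro ε hε
  obtain ⟨M, hM0, hM⟩ := htail ε hε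
  refine ⟨C * (M + K), hM.mono fun n hn => (measure_mono fun ω hω => ?_).trans hn⟩
  have hω' : C * (M + K) * (a n + c n) < |X n ω| := hω
  refine lt_of_le_of_lt ?_ hω'
  rw [mul_assoc]
  gcongr
  nlinarith [hb n, mul_nonneg hK (ha n), mul_nonneg hM0.le (hc n)]

end Rates

end SplineIV

end

/-! ### Uniform consistency and rates of the estimator -/

theorem theorem2 {Ω : Type*} [MeasurableSpace Ω] (P : Measure Ω) [IsProbabilityMeasure P]
    {p : ℕ}
    -- the population variables and the sample of independent copies
    (Y Z : Ω → ℝ) (W : Ω → E p) (hY : Measurable Y) (hZ : Measurable Z) (hW : Measurable W)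
    (Ys Zs : ℕ → Ω → ℝ) (Ws : ℕ → Ω → E p)
    (hindep : iIndepFun (fun i ω => (Ys i ω, Zs i ω, Ws i ω)) P)
    (hident : ∀ i, IdentDistrib (fun ω => (Ys i ω, Zs i ω, Ws i ω))
      (fun ω => (Y ω, Z ω, W ω)) P P)
    -- finite second moment, bounded density of `Z` on `[0,1]`
    (hY2 : MemLp Y 2 P)
    (fZ : ℝ → ℝ) (hfZ : Measurable fZ) (hfZ_bdd : ∃ C, ∀ z, fZ z ≤ C)
    (hfZ_density :
      P.map Z = (volume.restrict (Icc 0 1)).withDensity fun z => ENNReal.ofReal (fZ z))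
    -- a symmetric probability measure with full support
    (μ : Measure (E p)) [IsProbabilityMeasure μ]
    (hμ_symm : μ.map (fun t => -t) = μ) (hμ_supp : μ.support = Set.univ)
    -- at least one component of `W` is continuous
    (hW_cont : ∃ k : Fin p, ∀ c : ℝ, P {ω | W ω k = c} = 0)
    -- the model and completeness
    (g₀ : ℝ → ℝ) (hg₀ : g₀ ∈ spaceG)
    (hmodel : P[fun ω => Y ω - g₀ (Z ω) | MeasurableSpace.comap W inferInstance] =ᵐ[P] 0)
    (hcomplete : ∀ g₁ ∈ spaceG, ∀ g₂ ∈ spaceG,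
      P[fun ω => g₁ (Z ω) | MeasurableSpace.comap W inferInstance] =ᵐ[P]
        P[fun ω => g₂ (Z ω) | MeasurableSpace.comap W inferInstance] →
      EqOn g₁ g₂ (Icc 0 1))
    -- the regularization parameter
    (lam : ℕ → ℝ) (hlam_pos : ∀ n, 0 < lam n) (hlam : Tendsto lam atTop (𝓝 0))
    (hnlam : Tendsto (fun n : ℕ => (n : ℝ) * lam n) atTop atTop)
    -- the estimator computed from the first `n` observations
    (gHat : ℕ → Ω → ℝ → ℝ)
    (hgHat : ∀ n, ∀ᵐ ω ∂P, IsSplineEstimate μ (lam n) n (fun i => Ys i ω) (fun i => Zs i ω)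
      (fun i => Ws i ω) (gHat n ω)) :
    (TendstoInMeasure P (fun n ω => supDist (gHat n ω) g₀) atTop (fun _ => (0 : ℝ)) ∧
      TendstoInMeasure P (fun n ω => supDist (d1 (gHat n ω)) (d1 g₀)) atTop
        (fun _ => (0 : ℝ))) ∧
    ∀ γ : ℝ, 0 < γ → SourceCondition P μ Z hW g₀ γ →
      IsBigOP P (fun n ω => supDist (gHat n ω) g₀)
        (fun n => 1 / √((n : ℝ) * lam n) + lam n ^ (min γ 2 / 2)) ∧
      IsBigOP P (fun n ω => supDist (d1 (gHat n ω)) (d1 g₀))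
        (fun n => 1 / √((n : ℝ) * lam n) + lam n ^ (min γ 2 / 2)) := by
  have hZI : ∀ᵐ ω ∂P, Z ω ∈ Icc (0 : ℝ) 1 := by
    refine ae_of_ae_map hZ.aemeasurable ?_
    rw [hfZ_density]
    exact (withDensity_absolutelyContinuous _ _).ae_le (ae_restrict_mem measurableSet_Icc)
  let V : Ω → Obs p := fun ω => (Y ω, Z ω, W ω)
  have hV : Measurable V := hY.prodMk (hZ.prodMk hW)
  -- the observations are only almost everywhere measurable; pass to measurable versions
  let Vs : ℕ → Ω → Obs p := fun i => (hident i).aemeasurable_fst.mk _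
  have hVs : ∀ i, Measurable (Vs i) := fun i => (hident i).aemeasurable_fst.measurable_mk
  have hVs_ae : ∀ i, (fun ω => (Ys i ω, Zs i ω, Ws i ω)) =ᵐ[P] Vs i := fun i =>
    (hident i).aemeasurable_fst.ae_eq_mk
  have hindep' : iIndepFun Vs P := hindep.congr hVs_ae
  have hident' : ∀ i, IdentDistrib (Vs i) V P P := fun i =>
    (IdentDistrib.of_ae_eq (hident i).aemeasurable_fst (hVs_ae i)).symm.trans (hident i)
  have hVsI : ∀ᵐ ω ∂P, ∀ i, (Vs i ω).2.1 ∈ Icc (0 : ℝ) 1 := ae_all_iff.2 fun i =>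
    (hident' i).symm.ae_snd (p := fun v : Obs p => v.2.1 ∈ Icc (0 : ℝ) 1)
      (measurableSet_Icc.preimage measurable_snd.fst) hZI
  have hest : ∀ n, ∀ᵐ ω ∂P, IsSplineEstimate μ (lam n) n (fun i => (Vs i ω).1)
      (fun i => (Vs i ω).2.1) (fun i => (Vs i ω).2.2) (gHat n ω) := fun n => by
    filter_upwards [hgHat n, ae_all_iff.2 hVs_ae] with ω hω he
    simpa only [← he] using hω
  set x₀ := coef g₀ hg₀ with hx₀
  have hnoise : ∀ t, expMoment P (fun ω => (V ω).2.2)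
      (fun ω => (V ω).1 - spl x₀ (V ω).2.1) t = 0 := by
    refine expMoment_eq_zero_of_condExp hW ((hY2.sub (memLp_spl hZ hZI x₀ 2)).integrable
      (by norm_num)) ((condExp_congr_ae ?_).trans hmodel)
    filter_upwards [hZI] with ω hω
    simp only [V, hx₀, spl_coef hg₀ hω]
  have hinj := opS_injective P μ hZ hZI hW hμ_supp hcomplete
  obtain ⟨C, η, hC, hη, hmain⟩ := exists_norm_coef_sub_le (μ := μ) hV hZI hinj hnoise
  choose k hk using fun n =>
    exists_isTikhonovBias (profileOp (opS P μ hZ hZI hW)) (hlam_pos n) x₀.2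
  -- the common tail bound for the errors of the function and of its derivative
  have htail : ∀ X : ℕ → Ω → ℝ, (∀ n ω (h : gHat n ω ∈ spaceG), |X n ω| ≤
      3 * ‖coef (gHat n ω) h - x₀‖) → ∀ ε, 0 < ε → ∃ M, 0 < M ∧ ∀ᶠ n : ℕ in atTop,
        P {ω | 3 * C * (M * (1 / √((n : ℝ) * lam n)) + ‖k n‖) < |X n ω|} ≤
          ENNReal.ofReal ε := by
    intro X hX ε hε
    obtain ⟨M, hM, hdev⟩ := exists_measure_totalDev_le μ hindep' hident' hV hVs hZI hY2 x₀ hε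
    refine ⟨√M, Real.sqrt_pos.2 hM, ?_⟩
    have hsmall : Tendsto (fun n : ℕ => √(M / n)) atTop (𝓝 0) := by
      have := (tendsto_const_div_atTop_nhds_zero_nat M).sqrt
      rwa [Real.sqrt_zero] at this
    filter_upwards [eventually_ne_atTop 0, hsmall.eventually (ge_mem_nhds hη),
      hlam.eventually (ge_mem_nhds one_pos)] with n hn hnη hn1
    refine (measure_mono_ae ?_).trans (hdev n hn)
    filter_upwards [hVsI, hest n] with ω hωI hωE hω
    change ENNReal.ofReal (M / n) ≤ totalDev P V μ x₀ n fun i => Vs i ω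
    by_contra! hcon
    have h1 := hmain (lam n) n M (fun i => Vs i ω) (gHat n ω) (k n) (hlam_pos n) hn1 hnη (hk n)
      hcon.le hωI hωE
    have h2 := hX n ω hωE.1
    have h3 : √(M / n) / √(lam n) = √M * (1 / √((n : ℝ) * lam n)) := by
      rw [Real.sqrt_div hM.le, Real.sqrt_mul (Nat.cast_nonneg n)]
      ring
    rw [h3] at h1
    have h4 : 3 * C * (√M * (1 / √((n : ℝ) * lam n)) + ‖k n‖) < |X n ω| := hω
    linarith
  have hX1 : ∀ n ω (h : gHat n ω ∈ spaceG), |supDist (gHat n ω) g₀| ≤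
      3 * ‖coef (gHat n ω) h - x₀‖ := fun n ω h => (supDist_le h hg₀).1
  have hX2 : ∀ n ω (h : gHat n ω ∈ spaceG), |supDist (d1 (gHat n ω)) (d1 g₀)| ≤
      3 * ‖coef (gHat n ω) h - x₀‖ := fun n ω h => (supDist_le h hg₀).2
  refine ⟨?_, fun γ hγ hsource => ?_⟩
  · have hrate : Tendsto (fun n : ℕ => 1 / √((n : ℝ) * lam n)) atTop (𝓝 0) := by
      simp only [one_div]
      exact (Real.tendsto_sqrt_atTop.comp hnlam).inv_tendsto_atTop
    have hbias := tendsto_tikhonovBias _ (profileOp_injective hinj) hlam_pos hlam hk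
    exact ⟨tendstoInMeasure_of_tail hrate hbias (htail _ hX1),
      tendstoInMeasure_of_tail hrate hbias (htail _ hX2)⟩
  · obtain ⟨σ, φ, ψ, hsys, hsum⟩ := hsource
    set T := profileOp (opS P μ hZ hZI hW) with hT
    have hTφ : ∀ {h : ℝ → ℝ} (hh : h ∈ spaceH), opT P μ Z hW h = T (coef h hh.1).2 := fun hh =>
      opT_eq P μ hZ hZI hW hh
    have hspl : ∀ u : L2I, spl (0, u) ∈ spaceH := fun u =>
      ⟨spl_mem_spaceG _, by rw [spl_zero]; rfl, by rw [d1_spl_zero]; rfl⟩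
    have hcspl : ∀ u : L2I, (coef (spl (0, u)) (hspl u).1).2 = u := fun u => by rw [coef_spl]
    have hpart : ∀ z, partH g₀ z = g₀ z - spl ((g₀ 0, d1 g₀ 0), 0) z := fun z => by
      rw [spl_affine, partH]
      ring
    have hpartE : EqOn (partH g₀) (spl (0, x₀.2)) (Icc 0 1) := fun z hz => by
      rw [hpart, ← spl_coef hg₀ hz, ← spl_sub]
      congr 1
      refine Prod.ext ?_ ?_
      · simp [coef]
      · simp [hx₀]
    have hinner : ∀ j, innerH (partH g₀) (φ j) =
        inner ℝ x₀.2 (coef (φ j) (hsys.mem j).1).2 := fun j => by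
      have h1 : innerH (partH g₀) (φ j) = innerH (spl (0, x₀.2)) (φ j) := by
        refine intervalIntegral.integral_congr fun z hz => ?_
        rw [uIcc_of_le zero_le_one] at hz
        simp only [d2_congr hpartE hz]
      rw [h1, innerH_eq (hspl x₀.2).1 (hsys.mem j).1, hcspl]
    have horth : Orthonormal ℝ fun j => (coef (φ j) (hsys.mem j).1).2 := by
      rw [orthonormal_iff_ite]
      intro i j
      rw [← innerH_eq, hsys.orthonormal_left]
    have htotal : ∀ u : L2I, (∀ j, inner ℝ u (coef (φ j) (hsys.mem j).1).2 = 0) → u = 0 := by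
      intro u hu
      have h1 := hsys.complete _ (hspl u) fun j => by
        rw [innerH_eq (hspl u).1 (hsys.mem j).1, hcspl]
        exact hu j
      rw [hTφ (hspl u), hcspl] at h1
      exact profileOp_injective hinj (h1.trans (map_zero _).symm)
    have hmap : ∀ j, T (coef (φ j) (hsys.mem j).1).2 = σ j • ψ j := fun j => by
      rw [← hTφ (hsys.mem j), hsys.map_eq]
    have hadj : ∀ j u, inner ℝ (T u) (ψ j) = σ j * inner ℝ u (coef (φ j) (hsys.mem j).1).2 := by
      intro j u
      have h1 := hsys.adjoint_eq j _ (hspl u)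
      rwa [hTφ (hspl u), hcspl, innerH_eq (hspl u).1 (hsys.mem j).1, hcspl] at h1
    simp only [hinner] at hsum
    obtain ⟨K, hK⟩ := exists_tikhonovBias_le T hsys.pos horth htotal hsys.orthonormal_right hmap
      hadj hγ hsum
    have hb : ∀ n, ‖k n‖ ≤ |K| * lam n ^ (min γ 2 / 2) := fun n =>
      (hK _ (hlam_pos n) _ (hk n)).trans (mul_le_mul_of_nonneg_right (le_abs_self K)
        (Real.rpow_nonneg (hlam_pos n).le _))
    have ha : ∀ n : ℕ, 0 ≤ 1 / √((n : ℝ) * lam n) := fun n => by positivity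
    have hc : ∀ n, 0 ≤ lam n ^ (min γ 2 / 2) := fun n => Real.rpow_nonneg (hlam_pos n).le _
    exact ⟨isBigOP_of_tail (by positivity) (abs_nonneg K) ha hc hb (htail _ hX1),
      isBigOP_of_tail (by positivity) (abs_nonneg K) ha hc hb (htail _ hX2)⟩
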